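/- For an even positive integer $M$ put $\mathcal I_M=\{-\tfrac M2,1-\tfrac M2,\dots,\tfrac M2-1\}$. Let $N\in\mathbb N$, $N\ge 1$, and let $\sigma_1,\sigma_2\in[\tfrac54,2]$ be such that $N_1:=\sigma_1N$ is an even integer and, for a given integer $m_1\ge 2$, also $N_2:=\sigma_2(N_1+2m_1)$ is an even integer. Let $m_2\ge m_1$ be an integer with $2m_2\le(1-\tfrac1{\sigma_1})N_2$, and put $a:=1+\tfrac{2m_1}{N_1}$. For $j=1,2$ let $\beta_j:=2\pi m_j\bigl(1-\tfrac1{2\sigma_j}\bigr)$ and let $\varphi_{\sinh,j}(t):=\omega_j(N_jt/m_j)$, $t\in\mathbb R$, be the sinh-type window function, where $\omega_j(x)=\sinh(\beta_j\sqrt{1-x^2})/\sinh\beta_j$ for $|x|\le1$ and $\omega_j(x)=0$ for $|x|>1$. Write $\hat\varphi(v)=\int_{\mathbb R}\varphi(t)\,e^{-2\pi i vt}\,dt$. Let $M_1,M_2$ be positive even integers, $f_k\in\mathbb C$ and $v_k\in[-\tfrac1{2a},\tfrac1{2a}]$ for $k\in\mathcal I_{M_1}$, $x_j\in[-\tfrac12,\tfrac12]$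 for $j\in\mathcal I_{M_2}$, and $$f(x):=\sum_{k\in\mathcal I_{M_1}}f_k\,e^{-2\pi iNv_kx},\qquad x\in[-\tfrac12,\tfrac12].$$ The NNFFT approximates $f(x)$ by $s_1(Nx)/\hat\varphi_{\sinh,1}(Nx)$, where $$g_\ell:=\frac1{N_1}\sum_{k\in\mathcal I_{M_1}}f_k\,\varphi_{\sinh,1}\Bigl(\frac{\ell}{N_1}-v_k\Bigr)\quad(\ell\in\mathcal I_{N_1+2m_1}),\qquad h_s:=\frac1{N_2}\sum_{\ell\in\mathcal I_{N_1+2m_1}}\frac{g_\ell}{\hat\varphi_{\sinh,2}(\ell)}\,e^{-2\pi i\ell s/N_2}\quad(s\in\mathcal I_{N_2}),$$ $$s_1(Nx):=\sum_{\substack{s\in\mathcal I_{N_2}\\|s/N_2-x/\sigma_1|<m_2/N_2}}h_s\,\varphi_{\sinh,2}\Bigl(\frac{x}{\sigma_1}-\frac{s}{N_2}\Bigr).$$ Then the denominators $\hat\varphi_{\sinh,1}(Nx)$, $x\in[-\tfrac12,\tfrac12]$, and $\hat\varphi_{\sinh,2}(\ell)$, $\ell\in\mathcal I_{N_1+2m_1}$,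 do not vanish, the maxima below exist, and $$\max_{j\in\mathcal I_{M_2}}\Bigl|f(x_j)-\frac{s_1(Nx_j)}{\hat\varphi_{\sinh,1}(Nx_j)}\Bigr|\le\max_{x\in[-1/2,1/2]}\Bigl|f(x)-\frac{s_1(Nx)}{\hat\varphi_{\sinh,1}(Nx)}\Bigr|\le E(\varphi_{\sinh})\sum_{k\in\mathcal I_{M_1}}|f_k|$$ with the constant $$E(\varphi_{\sinh}):=(24m_1^{3/2}+10)\,e^{-2\pi m_1\sqrt{1-1/\sigma_1}}+(24m_2^{3/2}+10)\,\frac{2N_1+4m_1}{\sqrt{2m_1\pi}}\,e^{2\pi m_1\left(1-\sqrt{1-1/\sigma_1}-1/(2\sigma_1)\right)}\,e^{-2\pi m_2\sqrt{1-1/\sigma_2}}.$$ -/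

import Mathlib

open scoped FourierTransform

noncomputable section

namespace NNFFT

/-- For even `M`, the index set `{-M/2, 1 - M/2, …, M/2 - 1}`. -/
def indexSet (M : ℕ) : Finset ℤ :=
  Finset.Ico (-((M : ℤ) / 2)) ((M : ℤ) / 2)

/-- The exponential sum `f(x) = ∑ f_k e^{-2π i N v_k x}`, `k` running through `indexSet M₁`. -/
def expSum (N M₁ : ℕ) (v : ℤ → ℝ) (f : ℤ → ℂ) (x : ℝ) : ℂ :=
  ∑ k ∈ indexSet M₁,
    f k * Complex.exp (-2 * (Real.pi : ℂ) * Complex.I * ((N : ℝ) * v k * x : ℝ))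

/-- The shape parameter `β = 2π m (1 - 1/(2σ))`. -/
def shapeParam (m : ℕ) (σ : ℝ) : ℝ :=
  2 * Real.pi * m * (1 - 1 / (2 * σ))

/-- `ω(x) = sinh(β √(1 - x²)) / sinh β` on `[-1, 1]`, and `0` elsewhere. -/
def omegaSinh (β x : ℝ) : ℝ :=
  open Classical in
  if x ∈ Set.Icc (-1 : ℝ) 1 then Real.sinh (β * Real.sqrt (1 - x ^ 2)) / Real.sinh β else 0

/-- The sinh-type window function `φ(t) = ω(L t / m)` with truncation parameter `m`,
oversampling factor `σ` and grid size `L`. -/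
def phiSinh (m : ℕ) (σ : ℝ) (L : ℕ) (t : ℝ) : ℝ :=
  omegaSinh (shapeParam m σ) ((L : ℝ) * t / m)

/-- The Fourier transform `φ̂(v) = ∫ φ(t) e^{-2π i v t} dt` of a real-valued function. -/
def hat (φ : ℝ → ℝ) (v : ℝ) : ℂ :=
  𝓕 (fun t : ℝ => (φ t : ℂ)) v

/-- `a = 1 + 2 m₁ / N₁`. -/
def aConst (m₁ N₁ : ℕ) : ℝ :=
  1 + 2 * (m₁ : ℝ) / N₁

/-- Step 1 of the NNFFT: `g_ℓ = (1/N₁) ∑ f_k φ₁(ℓ/N₁ - v_k)`. -/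
def gCoeff (φ₁ : ℝ → ℝ) (N₁ M₁ : ℕ) (v : ℤ → ℝ) (f : ℤ → ℂ) (l : ℤ) : ℂ :=
  1 / (N₁ : ℂ) * ∑ k ∈ indexSet M₁, f k * (φ₁ ((l : ℝ) / N₁ - v k) : ℂ)

/-- Step 2 of the NNFFT: `ĝ_ℓ = g_ℓ / φ̂₂(ℓ)`. -/
def gHatCoeff (φ₁ φ₂ : ℝ → ℝ) (N₁ M₁ : ℕ) (v : ℤ → ℝ) (f : ℤ → ℂ) (l : ℤ) : ℂ :=
  gCoeff φ₁ N₁ M₁ v f l / hat φ₂ l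

/-- Step 3 of the NNFFT: `h_s = (1/N₂) ∑ ĝ_ℓ e^{-2π i ℓ s / N₂}`,
`ℓ` running through `indexSet (N₁ + 2 m₁)`. -/
def hCoeff (φ₁ φ₂ : ℝ → ℝ) (N₁ N₂ m₁ M₁ : ℕ) (v : ℤ → ℝ) (f : ℤ → ℂ) (s : ℤ) : ℂ :=
  1 / (N₂ : ℂ) * ∑ l ∈ indexSet (N₁ + 2 * m₁),
    gHatCoeff φ₁ φ₂ N₁ M₁ v f l *
      Complex.exp (-2 * (Real.pi : ℂ) * Complex.I * ((l : ℝ) * s / N₂ : ℝ))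

/-- Step 4 of the NNFFT at the spatial point `x`, i.e. the value `s₁(N x)`: the sum of
`h_s φ₂(x/σ₁ - s/N₂)` over those `s` in `indexSet N₂` with `|s/N₂ - x/σ₁| < m₂/N₂`. -/
def shortSum (φ₁ φ₂ : ℝ → ℝ) (σ₁ : ℝ) (N₁ N₂ m₁ m₂ M₁ : ℕ) (v : ℤ → ℝ) (f : ℤ → ℂ)
    (x : ℝ) : ℂ :=
  open Classical in
  ∑ s ∈ (indexSet N₂).filter (fun s : ℤ => |(s : ℝ) / N₂ - x / σ₁| < (m₂ : ℝ) / N₂),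
    hCoeff φ₁ φ₂ N₁ N₂ m₁ M₁ v f s * (φ₂ (x / σ₁ - (s : ℝ) / N₂) : ℂ)

/-- The value `s₁(N x) / φ̂₁(N x)` that the NNFFT returns at the spatial point `x`. -/
def nnfft (φ₁ φ₂ : ℝ → ℝ) (σ₁ : ℝ) (N N₁ N₂ m₁ m₂ M₁ : ℕ) (v : ℤ → ℝ) (f : ℤ → ℂ)
    (x : ℝ) : ℂ :=
  shortSum φ₁ φ₂ σ₁ N₁ N₂ m₁ m₂ M₁ v f x / hat φ₁ ((N : ℝ) * x)

/-- The NNFFT with the two sinh-type windows. -/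
def nnfftSinh (σ₁ σ₂ : ℝ) (N N₁ N₂ m₁ m₂ M₁ : ℕ) (v : ℤ → ℝ) (f : ℤ → ℂ) (x : ℝ) : ℂ :=
  nnfft (phiSinh m₁ σ₁ N₁) (phiSinh m₂ σ₂ N₂) σ₁ N N₁ N₂ m₁ m₂ M₁ v f x

/-- The constant `E(φ_sinh)`. -/
def errorConst (σ₁ σ₂ : ℝ) (N₁ m₁ m₂ : ℕ) : ℝ :=
  (24 * (m₁ : ℝ) ^ (3 / 2 : ℝ) + 10) *
      Real.exp (-2 * Real.pi * m₁ * Real.sqrt (1 - 1 / σ₁)) +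
    (24 * (m₂ : ℝ) ^ (3 / 2 : ℝ) + 10) *
      ((2 * (N₁ : ℝ) + 4 * m₁) / Real.sqrt (2 * m₁ * Real.pi)) *
      Real.exp (2 * Real.pi * m₁ * (1 - Real.sqrt (1 - 1 / σ₁) - 1 / (2 * σ₁))) *
      Real.exp (-2 * Real.pi * m₂ * Real.sqrt (1 - 1 / σ₂))

end NNFFT

end

/-! Write τ = 1/(2σ), b = 2πm(1-τ) and W(b,u) = ∫_{-1}^1 sinh(b√(1-x²)) e^{iux} dx. Up to a positive
factor, the transform of a window on a grid of size L is W(b, 2πm v/L). With x = cos θ, 2W becomes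
an integral over a period, and a contour shift evaluates it: for |u| < b it equals a multiple of
W(w,0) with w = √(b²-u²), a modified Bessel function growing like e^w; for |u| > b it is an
oscillatory J₁ integral. The shape parameter puts the threshold between the two kinds of frequency:
|v/L| ≤ τ gives w ≥ 2πm√(1-1/σ), while every alias v + rL, r ≠ 0, has |u| ≥ b.

By Poisson summation the error of a sum of translated windows, as an approximation of an
exponential, is the sum of these aliases. It is at most (5/2)b, in units where the main term is at
least b e^z z^{-3/2} with z = 2πm√(1-1/σ); the quotient gives the relative error `windowError`
(`norm_window_sum_sub_le`). Compact support makes both truncations exact.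

Interchanging sums, s₁(Nx) = ∑ g_l A_l. The second window gives A_l ≈ e^{-2πi l x/σ₁}, and the first
gives ∑ g_l e^{-2πi l x/σ₁} ≈ φ̂₁(Nx) f(x). Dividing by φ̂₁(Nx) leaves the first window's error plus
the second's times ∑|g_l|/|φ̂₁(Nx)|. That ratio is controlled by ∑|g_l| ≤ (3m₁/(2N₁)) ∑|f_k| and the
lower bound `le_mul_norm_hat_phiSinh`. -/

namespace NNFFT

open Complex MeasureTheory intervalIntegral Set

/-! ### Contour shifts and Bessel integrals -/

/-- The integral of an entire `2π`-periodic function over a period does not change when the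
horizontal contour is shifted. -/
theorem integral_periodic_shift {Φ : ℂ → ℂ} (hΦ : Differentiable ℂ Φ)
    (hper : ∀ z, Φ (z + 2 * Real.pi) = Φ z) (τ : ℝ) :
    ∫ θ in (-Real.pi)..Real.pi, Φ (θ + τ * I) = ∫ θ in (-Real.pi)..Real.pi, Φ θ := by
  have h := integral_boundary_rect_eq_zero_of_differentiableOn Φ ((-Real.pi : ℝ) : ℂ)
    ((Real.pi : ℝ) + (τ : ℝ) * I) hΦ.differentiableOn
  -- Periodicity makes the two vertical sides of the rectangle cancel.
  have hside : ∀ y : ℝ, Φ ((Real.pi : ℂ) + y * I) = Φ (-(Real.pi : ℂ) + y * I) := by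
    intro y
    rw [← hper (-(Real.pi : ℂ) + y * I)]
    congr 1
    ring
  simp [hside] at h
  exact (sub_eq_zero.mp h).symm

/-- Twice the Fourier integral of `sinh (b √(1 - x²))` over `[-1, 1]`, in the angular variable. -/
noncomputable def angularIntegral (b u : ℝ) : ℂ :=
  ∫ θ in (-Real.pi)..Real.pi,
    (Real.sin θ : ℂ) * exp (b * Real.sin θ + u * Real.cos θ * I)

/-- The integrand is the derivative of a periodic function, `exp (c * sin θ) / c`, or `sin` when c =
0. This and the odd integral that follows remove the extra terms left by the contour shifts. -/
theorem integral_cos_mul_exp_sin (c : ℂ) :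
    ∫ θ : ℝ in (-Real.pi)..Real.pi, cos (θ : ℂ) * exp (c * sin (θ : ℂ)) = 0 := by
  by_cases hc : c = 0
  · subst hc
    have : ∀ θ : ℝ, HasDerivAt (fun x : ℝ => sin (x : ℂ)) (cos (θ : ℂ)) θ := fun θ =>
      (hasDerivAt_sin (θ : ℂ)).comp_ofReal
    simp only [zero_mul, exp_zero, mul_one]
    rw [integral_eq_sub_of_hasDerivAt (fun θ _ => this θ)
      (Continuous.intervalIntegrable (by fun_prop) _ _)]
    simp
  · have : ∀ θ : ℝ, HasDerivAt (fun x : ℝ => exp (c * sin (x : ℂ)) / c)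
        (cos (θ : ℂ) * exp (c * sin (θ : ℂ))) θ := by
      intro θ
      have h := (((hasDerivAt_sin (θ : ℂ)).const_mul c).cexp.div_const c).comp_ofReal
      convert h using 1
      field_simp
    rw [integral_eq_sub_of_hasDerivAt (fun θ _ => this θ)
      (Continuous.intervalIntegrable (by fun_prop) _ _)]
    simp

theorem integral_sin_mul_exp_cos (c : ℂ) :
    ∫ θ : ℝ in (-Real.pi)..Real.pi, sin (θ : ℂ) * exp (c * cos (θ : ℂ)) = 0 := by
  have h := integral_comp_neg (a := -Real.pi) (b := Real.pi)
    (fun θ : ℝ => sin (θ : ℂ) * exp (c * cos (θ : ℂ)))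
  simp only [ofReal_neg, sin_neg, cos_neg, neg_mul, intervalIntegral.integral_neg, neg_neg] at h
  exact CharZero.neg_eq_self_iff.mp h

/-- Shifting the contour below the exponential threshold `|u| < b`. -/
theorem angularIntegral_cosh_sinh (z τ : ℝ) :
    angularIntegral (z * Real.cosh τ) (z * Real.sinh τ) =
      Real.cosh τ * angularIntegral z 0 := by
  -- The prefactor of Φ is sin(w - iτ), so it becomes sin θ on the shifted line, where z sin w
  -- expands to z cosh τ sin θ + i z sinh τ cos θ.
  have h := integral_periodic_shift
    (Φ := fun w => (sin w * cosh τ - I * cos w * sinh τ) * exp (z * sin w))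
    (by fun_prop) (fun w => by simp only [sin_add_two_pi, cos_add_two_pi]) τ
  have h1 : ∀ θ : ℝ, (sin (θ + τ * I) * cosh τ - I * cos (θ + τ * I) * sinh τ) *
      exp (z * sin (θ + τ * I)) = (Real.sin θ : ℂ) * exp ((z * Real.cosh τ : ℝ) * Real.sin θ +
        (z * Real.sinh τ : ℝ) * Real.cos θ * I) := by
    intro θ
    rw [sin_add, cos_add, sin_mul_I, cos_mul_I]
    push_cast
    have hcs := Complex.cosh_sq_sub_sinh_sq (τ : ℂ)
    congr 1
    · linear_combination (sin (θ : ℂ)) * hcs +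
        (- sinh (τ : ℂ) ^ 2 * sin (θ : ℂ) * (-1 : ℂ)) * (I_sq)
    · congr 1
      ring
  simp only [h1] at h
  rw [angularIntegral, h, angularIntegral]
  have e : ∀ θ : ℝ, (sin (θ : ℂ) * cosh τ - I * cos (θ : ℂ) * sinh τ) * exp (z * sin (θ : ℂ)) =
      cosh τ * (sin (θ : ℂ) * exp (z * sin (θ : ℂ))) -
        (I * sinh τ) * (cos (θ : ℂ) * exp (z * sin (θ : ℂ))) := fun θ => by ring
  simp only [e]
  rw [intervalIntegral.integral_sub (Continuous.intervalIntegrable (by fun_prop) _ _)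
    (Continuous.intervalIntegrable (by fun_prop) _ _), intervalIntegral.integral_const_mul,
    intervalIntegral.integral_const_mul, integral_cos_mul_exp_sin]
  simp

/-- The integral `∫ cos η e^{i y cos η} dη` over a period, that is `2π i J₁(y)`. -/
noncomputable def besselIntegral (y : ℝ) : ℂ :=
  ∫ η in (-Real.pi)..Real.pi, (Real.cos η : ℂ) * exp (y * Real.cos η * I)

/-- Shifting the contour above the exponential threshold `b < |u|`. -/
theorem angularIntegral_sinh_cosh (y τ : ℝ) :
    angularIntegral (y * Real.sinh τ) (y * Real.cosh τ) =
      -(I * Real.sinh τ * besselIntegral y) := by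
  have h := integral_periodic_shift
    (Φ := fun w => (sin w * cosh τ - I * cos w * sinh τ) * exp (y * I * cos w))
    (by fun_prop) (fun w => by simp only [sin_add_two_pi, cos_add_two_pi]) τ
  have h1 : ∀ θ : ℝ, (sin (θ + τ * I) * cosh τ - I * cos (θ + τ * I) * sinh τ) *
      exp (y * I * cos (θ + τ * I)) = (Real.sin θ : ℂ) * exp ((y * Real.sinh τ : ℝ) * Real.sin θ +
        (y * Real.cosh τ : ℝ) * Real.cos θ * I) := by
    intro θ
    rw [sin_add, cos_add, sin_mul_I, cos_mul_I]
    push_cast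
    have hcs := Complex.cosh_sq_sub_sinh_sq (τ : ℂ)
    congr 1
    · linear_combination (sin (θ : ℂ)) * hcs +
        (- sinh (τ : ℂ) ^ 2 * sin (θ : ℂ) * (-1 : ℂ)) * (I_sq)
    · congr 1
      linear_combination (- (y : ℂ) * sin (θ : ℂ) * sinh (τ : ℂ)) * I_sq
  simp only [h1] at h
  rw [angularIntegral, h, besselIntegral]
  have e : ∀ θ : ℝ, (sin (θ : ℂ) * cosh τ - I * cos (θ : ℂ) * sinh τ) * exp (y * I * cos (θ : ℂ)) =
      cosh τ * (sin (θ : ℂ) * exp ((y * I) * cos (θ : ℂ))) -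
        (I * sinh τ) * (cos (θ : ℂ) * exp (y * cos (θ : ℂ) * I)) := fun θ => by
    rw [show (y : ℂ) * cos (θ : ℂ) * I = y * I * cos (θ : ℂ) by ring]
    ring
  simp only [e]
  rw [intervalIntegral.integral_sub (Continuous.intervalIntegrable (by fun_prop) _ _)
    (Continuous.intervalIntegrable (by fun_prop) _ _), intervalIntegral.integral_const_mul,
    intervalIntegral.integral_const_mul, integral_sin_mul_exp_cos]
  simp

/-- Since cos has mean zero, the exponential may be replaced by e^{is} - 1, of size at most |s|;
then ∫ cos² = π. -/
theorem norm_besselIntegral_le_mul_abs (y : ℝ) : ‖besselIntegral y‖ ≤ Real.pi * |y| := by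
  have h0 : ∫ η : ℝ in (-Real.pi)..Real.pi, (Real.cos η : ℂ) = 0 := by
    rw [intervalIntegral.integral_ofReal, integral_cos]
    simp
  have h1 : besselIntegral y = ∫ η in (-Real.pi)..Real.pi,
      (Real.cos η : ℂ) * (exp ((y * Real.cos η : ℝ) * I) - 1) := by
    have e : ∀ η : ℝ, (Real.cos η : ℂ) * (exp ((y * Real.cos η : ℝ) * I) - 1) =
      (Real.cos η : ℂ) * exp (y * Real.cos η * I) - (Real.cos η : ℂ) := fun η => by
        push_cast; ring
    simp only [e]
    rw [intervalIntegral.integral_sub (Continuous.intervalIntegrable (by fun_prop) _ _)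
      (Continuous.intervalIntegrable (by fun_prop) _ _), h0, sub_zero, besselIntegral]
  rw [h1]
  have h2 : ∀ η : ℝ, ‖(Real.cos η : ℂ) * (exp ((y * Real.cos η : ℝ) * I) - 1)‖ ≤
      |y| * Real.cos η ^ 2 := by
    intro η
    rw [norm_mul, norm_real, Real.norm_eq_abs]
    have := Real.norm_exp_I_mul_ofReal_sub_one_le (x := y * Real.cos η)
    rw [mul_comm I, Real.norm_eq_abs, abs_mul] at this
    calc _ ≤ |Real.cos η| * (|y| * |Real.cos η|) := by gcongr
      _ = |y| * Real.cos η ^ 2 := by rw [← sq_abs (Real.cos η)]; ring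
  refine (norm_integral_le_of_norm_le (by linarith [Real.pi_pos])
    (Filter.Eventually.of_forall fun η _ => h2 η)
    (Continuous.intervalIntegrable (by fun_prop) _ _)).trans ?_
  rw [intervalIntegral.integral_const_mul, integral_cos_sq]
  simp
  apply le_of_eq
  ring

/-- The quarter-period piece of the Bessel integral. -/
theorem norm_integral_cos_mul_exp_le {y : ℝ} (hy : 1 ≤ |y|) :
    ‖∫ η in (0 : ℝ)..(Real.pi / 2), (Real.cos η : ℂ) * exp (y * Real.cos η * I)‖ ≤
      2 * √2 / √|y| := by
  have hy0 : y ≠ 0 := by rintro rfl; simp at hy; linarith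
  -- This d balances the trivial bound d on [0, d] against 2/(|y| d) on the rest.
  set d : ℝ := √(2 / |y|) with hd
  have hd0 : 0 < d := Real.sqrt_pos.2 (by positivity)
  have hd2 : d ^ 2 = 2 / |y| := Real.sq_sqrt (by positivity)
  have hdle : d < Real.pi / 2 := by
    have : d ^ 2 ≤ 2 := by rw [hd2]; exact div_le_self (by norm_num) hy
    nlinarith [Real.pi_gt_three]
  have hsin : ∀ η ∈ uIcc d (Real.pi / 2), 0 < Real.sin η := by
    intro η hη
    rw [uIcc_of_le hdle.le] at hη
    exact Real.sin_pos_of_pos_of_lt_pi (by linarith [hη.1]) (by linarith [hη.2, Real.pi_pos])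
  have hc : Continuous fun η : ℝ => (Real.cos η : ℂ) * exp (y * Real.cos η * I) := by fun_prop
  rw [← integral_add_adjacent_intervals (b := d) (hc.intervalIntegrable _ _)
    (hc.intervalIntegrable _ _)]
  have hnorm : ∀ η : ℝ, ‖exp (y * Real.cos η * I)‖ = 1 := fun η => by
    rw [← ofReal_mul]; exact norm_exp_ofReal_mul_I _
  have hleft : ‖∫ η in (0 : ℝ)..d, (Real.cos η : ℂ) * exp (y * Real.cos η * I)‖ ≤ d := by
    refine (intervalIntegral.norm_integral_le_of_norm_le_const (C := 1) fun η _ => ?_).trans ?_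
    · rw [norm_mul, hnorm, mul_one, norm_real]
      exact Real.abs_cos_le_one η
    · simp [abs_of_pos hd0]
  have hcotd : ∀ η ∈ uIcc d (Real.pi / 2),
      HasDerivAt (fun x : ℝ => Real.cos x / Real.sin x) (-(1 / Real.sin η ^ 2)) η := by
    intro η hη
    refine ((Real.hasDerivAt_cos η).div (Real.hasDerivAt_sin η) (hsin η hη).ne').congr_deriv ?_
    symm
    rw [eq_div_iff (pow_ne_zero 2 (hsin η hη).ne'), neg_mul,
      one_div_mul_cancel (pow_ne_zero 2 (hsin η hη).ne')]
    linarith [Real.sin_sq_add_cos_sq η]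
  have hcont : ContinuousOn (fun η : ℝ => -(1 / Real.sin η ^ 2)) (uIcc d (Real.pi / 2)) :=
    (continuousOn_const.div (by fun_prop) fun η hη => pow_ne_zero 2 (hsin η hη).ne').neg
  have hcotle : Real.cos d / Real.sin d ≤ 1 / d := by
    have hs := hsin d left_mem_uIcc
    have hcd : 0 < Real.cos d := Real.cos_pos_of_mem_Ioo ⟨by linarith [Real.pi_pos], hdle⟩
    have := Real.lt_tan hd0 hdle
    rw [Real.tan_eq_sin_div_cos, lt_div_iff₀ hcd] at this
    rw [div_le_div_iff₀ hs hd0]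
    linarith
  have hcot0 : 0 ≤ Real.cos d / Real.sin d :=
    div_nonneg (Real.cos_pos_of_mem_Ioo ⟨by linarith [Real.pi_pos], hdle⟩).le
      (hsin d left_mem_uIcc).le
  -- Integrate by parts with cos η = cot η · sin η, the factor sin η coming from the phase. As cot
  -- is monotone, its variation and its boundary term are both cot d ≤ 1/d.
  have hright : ‖∫ η in d..(Real.pi / 2), (Real.cos η : ℂ) * exp (y * Real.cos η * I)‖ ≤
      2 / (|y| * d) := by
    have hv : ∀ η ∈ uIcc d (Real.pi / 2), HasDerivAt (fun x : ℝ => exp (y * Real.cos x * I))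
        (-(y * I) * (Real.sin η * exp (y * Real.cos η * I))) η := by
      intro η _
      have := (((Real.hasDerivAt_cos η).ofReal_comp.const_mul (y : ℂ)).mul_const I).cexp
      convert this using 1
      push_cast
      ring
    have hu : ∀ η ∈ uIcc d (Real.pi / 2),
        HasDerivAt (fun x : ℝ => ((Real.cos x / Real.sin x : ℝ) : ℂ))
          ((-(1 / Real.sin η ^ 2) : ℝ) : ℂ) η := fun η hη => (hcotd η hη).ofReal_comp
    have hparts := integral_mul_deriv_eq_deriv_mul hu hv
      (ContinuousOn.intervalIntegrable (by exact continuous_ofReal.comp_continuousOn hcont))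
      (Continuous.intervalIntegrable (by fun_prop) _ _)
    have hcongr : ∫ η in d..(Real.pi / 2), ((Real.cos η / Real.sin η : ℝ) : ℂ) *
        (-(y * I) * (Real.sin η * exp (y * Real.cos η * I))) =
        -(y * I) * ∫ η in d..(Real.pi / 2), (Real.cos η : ℂ) * exp (y * Real.cos η * I) := by
      rw [← intervalIntegral.integral_const_mul]
      refine integral_congr fun η hη => ?_
      have : (Real.sin η : ℂ) ≠ 0 := ofReal_ne_zero.2 (hsin η hη).ne'
      simp only [ofReal_div]
      field_simp
    rw [hcongr] at hparts
    have hbd : ‖∫ η in d..(Real.pi / 2), ((-(1 / Real.sin η ^ 2) : ℝ) : ℂ) *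
        exp (y * Real.cos η * I)‖ ≤ Real.cos d / Real.sin d := by
      refine (norm_integral_le_of_norm_le (g := fun η => -(-(1 / Real.sin η ^ 2))) hdle.le
        (Filter.Eventually.of_forall fun η hη => ?_) (hcont.neg.intervalIntegrable)).trans ?_
      · rw [norm_mul, hnorm, mul_one, norm_real, Real.norm_eq_abs, abs_neg, neg_neg, abs_of_nonneg
          (by positivity)]
      · rw [intervalIntegral.integral_neg,
          integral_eq_sub_of_hasDerivAt hcotd hcont.intervalIntegrable]
        simp
    have hfin : ‖-(y * I : ℂ) * ∫ η in d..(Real.pi / 2),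
        (Real.cos η : ℂ) * exp (y * Real.cos η * I)‖ ≤ 2 / d := by
      rw [hparts]
      refine (norm_sub_le _ _).trans ?_
      have : ‖((Real.cos (Real.pi / 2) / Real.sin (Real.pi / 2) : ℝ) : ℂ) *
          exp (y * Real.cos (Real.pi / 2) * I) - ((Real.cos d / Real.sin d : ℝ) : ℂ) *
          exp (y * Real.cos d * I)‖ = Real.cos d / Real.sin d := by
        rw [Real.cos_pi_div_two]
        simp only [zero_div, ofReal_zero, zero_mul, zero_sub, norm_neg]
        rw [norm_mul, hnorm, mul_one, norm_real, Real.norm_eq_abs, abs_of_nonneg hcot0]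
      rw [this]
      calc _ ≤ 1 / d + 1 / d := by linarith
        _ = 2 / d := by ring
    rw [norm_mul, norm_neg, norm_mul, norm_I, mul_one, norm_real, Real.norm_eq_abs] at hfin
    have hypos : 0 < |y| := abs_pos.2 hy0
    rw [← div_div, div_right_comm, le_div_iff₀ hypos]
    linarith
  refine (norm_add_le _ _).trans ((add_le_add hleft hright).trans (le_of_eq ?_))
  have hypos : 0 < |y| := abs_pos.2 hy0
  have e1 : 2 / (|y| * d) = d := by
    rw [div_eq_iff (by positivity), ← mul_assoc, mul_comm d, mul_assoc, ← sq, hd2]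
    field_simp
  rw [e1, hd, Real.sqrt_div (by norm_num)]
  ring

/-- The reflections η ↦ -η and η ↦ π - η reduce the period to quarter periods with parameters y and
-y. -/
theorem norm_besselIntegral_le_div_sqrt {y : ℝ} (hy : 1 ≤ |y|) :
    ‖besselIntegral y‖ ≤ 8 * √2 / √|y| := by
  set Q : ℝ → ℂ := fun y => ∫ η in (0 : ℝ)..(Real.pi / 2),
    (Real.cos η : ℂ) * exp (y * Real.cos η * I) with hQ
  have hc : Continuous fun η : ℝ => (Real.cos η : ℂ) * exp (y * Real.cos η * I) := by fun_prop
  have h1 : ∫ η in (-Real.pi)..0, (Real.cos η : ℂ) * exp (y * Real.cos η * I) =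
      ∫ η in (0 : ℝ)..Real.pi, (Real.cos η : ℂ) * exp (y * Real.cos η * I) := by
    have := integral_comp_neg (a := 0) (b := Real.pi)
      (fun η : ℝ => (Real.cos η : ℂ) * exp (y * Real.cos η * I))
    simp only [Real.cos_neg, neg_zero] at this
    exact this.symm
  have h2 : ∫ η in (Real.pi / 2)..Real.pi, (Real.cos η : ℂ) * exp (y * Real.cos η * I) =
      -Q (-y) := by
    have := integral_comp_sub_left (a := 0) (b := Real.pi / 2)
      (fun η : ℝ => (Real.cos η : ℂ) * exp (y * Real.cos η * I)) Real.pi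
    rw [sub_zero, sub_half] at this
    rw [← this, hQ, ← intervalIntegral.integral_neg]
    simp only [Real.cos_pi_sub, ofReal_neg, neg_mul, mul_neg]
  have h3 : besselIntegral y = 2 * (Q y - Q (-y)) := by
    rw [besselIntegral, ← integral_add_adjacent_intervals (b := 0) (hc.intervalIntegrable _ _)
      (hc.intervalIntegrable _ _), h1, ← integral_add_adjacent_intervals (a := 0)
      (b := Real.pi / 2) (c := Real.pi) (hc.intervalIntegrable _ _) (hc.intervalIntegrable _ _), h2]
    ring
  rw [h3, norm_mul]
  have b1 := norm_integral_cos_mul_exp_le hy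
  have b2 := norm_integral_cos_mul_exp_le (y := -y) (by rwa [abs_neg])
  rw [abs_neg] at b2
  have b3 := norm_sub_le (Q y) (Q (-y))
  calc ‖(2 : ℂ)‖ * ‖Q y - Q (-y)‖ ≤ 2 * (2 * √2 / √|y| + 2 * √2 / √|y|) := by
        rw [show ‖(2 : ℂ)‖ = 2 by simp]
        exact mul_le_mul_of_nonneg_left (b3.trans (add_le_add b1 b2)) (by norm_num)
    _ = 8 * √2 / √|y| := by ring

/-! ### The Fourier integral of the window above the threshold -/

/-- The Fourier integral of the unnormalized sinh-type window on `[-1, 1]`. -/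
noncomputable def windowIntegral (b u : ℝ) : ℂ :=
  ∫ x in (-1 : ℝ)..1, (Real.sinh (b * √(1 - x ^ 2)) : ℂ) * exp ((u * x : ℝ) * I)

/-- Under x = cos θ the root becomes sin θ on [0, π]; the two exponentials of sinh account for the
two halves of the period. -/
theorem two_mul_windowIntegral (b u : ℝ) : 2 * windowIntegral b u = angularIntegral b u := by
  have h1 : windowIntegral b u = ∫ θ in (0 : ℝ)..Real.pi,
      (Real.sin θ : ℂ) * (Real.sinh (b * Real.sin θ) * exp (u * Real.cos θ * I)) := by
    have h := integral_deriv_smul_comp (a := 0) (b := Real.pi)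
      (g := fun x : ℝ => (Real.sinh (b * √(1 - x ^ 2)) : ℂ) * exp ((u * x : ℝ) * I))
      (fun x _ => Real.hasDerivAt_cos x) (by fun_prop) (by fun_prop)
    rw [Real.cos_zero, Real.cos_pi, integral_symm (-1 : ℝ) 1, ← windowIntegral] at h
    rw [← neg_eq_iff_eq_neg.2 h, ← intervalIntegral.integral_neg]
    refine integral_congr fun θ hθ => ?_
    rw [uIcc_of_le Real.pi_pos.le] at hθ
    have : √(1 - Real.cos θ ^ 2) = Real.sin θ := by
      rw [← Real.sin_sq, Real.sqrt_sq (Real.sin_nonneg_of_mem_Icc hθ)]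
    simp [this]
  have hc : Continuous fun θ : ℝ =>
    (Real.sin θ : ℂ) * exp (b * Real.sin θ + u * Real.cos θ * I) := by fun_prop
  have hc' : Continuous fun θ : ℝ =>
    (-Real.sin θ : ℂ) * exp (-(b * Real.sin θ) + u * Real.cos θ * I) := by fun_prop
  have h2 : ∫ θ in (-Real.pi)..0, (Real.sin θ : ℂ) * exp (b * Real.sin θ + u * Real.cos θ * I) =
      ∫ θ in (0 : ℝ)..Real.pi,
        (-Real.sin θ : ℂ) * exp (-(b * Real.sin θ) + u * Real.cos θ * I) := by
    have := integral_comp_neg (a := 0) (b := Real.pi)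
      (fun θ : ℝ => (Real.sin θ : ℂ) * exp (b * Real.sin θ + u * Real.cos θ * I))
    simp only [Real.cos_neg, Real.sin_neg, neg_zero, ofReal_neg, mul_neg] at this
    exact this.symm
  rw [angularIntegral, ← integral_add_adjacent_intervals (b := 0) (hc.intervalIntegrable _ _)
    (hc.intervalIntegrable _ _), h2, ← intervalIntegral.integral_add (hc'.intervalIntegrable _ _)
    (hc.intervalIntegrable _ _), h1, ← intervalIntegral.integral_const_mul]
  refine integral_congr fun θ _ => ?_
  simp only [ofReal_sinh, ofReal_mul, Complex.sinh, exp_add]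
  ring

theorem continuous_windowIntegral (b : ℝ) : Continuous (windowIntegral b) := by
  unfold windowIntegral
  exact continuous_parametric_intervalIntegral_of_continuous' (by fun_prop) _ _

/-- Above the threshold the Fourier integral of the sinh window is a Bessel integral. -/
theorem norm_windowIntegral_eq {b u y : ℝ} (hy : 0 < y) (hb : 0 ≤ b) (h : u ^ 2 = b ^ 2 + y ^ 2) :
    ∃ y' : ℝ, |y'| = y ∧ ‖windowIntegral b u‖ = b / y * ‖besselIntegral y'‖ / 2 := by
  -- y' takes the sign of u, so that u / y' can be a hyperbolic cosine.
  obtain ⟨y', hy', hs⟩ : ∃ y' : ℝ, |y'| = y ∧ 0 ≤ u / y' := by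
    rcases le_total 0 u with hu | hu
    · exact ⟨y, abs_of_pos hy, by positivity⟩
    · exact ⟨-y, by rw [abs_neg, abs_of_pos hy], div_nonneg_of_nonpos hu (by linarith)⟩
  have hy0 : y' ≠ 0 := by
    rw [← abs_pos, hy']; exact hy
  refine ⟨y', hy', ?_⟩
  have hsq : y' ^ 2 = y ^ 2 := by rw [← hy', sq_abs]
  have key := angularIntegral_sinh_cosh y' (Real.arsinh (b / y'))
  have hc : Real.cosh (Real.arsinh (b / y')) = u / y' := by
    rw [Real.cosh_arsinh, ← Real.sqrt_sq hs]
    congr 1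
    rw [div_pow, div_pow, h, ← hsq]
    field_simp
    ring
  rw [hc, Real.sinh_arsinh, mul_div_cancel₀ _ hy0, mul_div_cancel₀ _ hy0,
    ← two_mul_windowIntegral] at key
  have := congrArg norm key
  rw [norm_mul, norm_neg, norm_mul, norm_mul, norm_I, norm_real, Real.norm_eq_abs, abs_div, hy',
    abs_of_nonneg hb, one_mul, show ‖(2 : ℂ)‖ = 2 by simp] at this
  linarith

theorem norm_windowIntegral_le_of_lt {b u : ℝ} (hb : 0 ≤ b) (h : b < |u|) :
    ‖windowIntegral b u‖ ≤ Real.pi / 2 * b := by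
  have hsq : b ^ 2 < u ^ 2 := by rw [← sq_abs u]; gcongr
  have hy : 0 < √(u ^ 2 - b ^ 2) := Real.sqrt_pos.2 (by linarith)
  obtain ⟨y', hy', h1⟩ := norm_windowIntegral_eq (u := u) hy hb
    (by rw [Real.sq_sqrt (by linarith)]; ring)
  have h2 := norm_besselIntegral_le_mul_abs y'
  rw [hy'] at h2
  rw [h1]
  calc _ ≤ b / √(u ^ 2 - b ^ 2) * (Real.pi * √(u ^ 2 - b ^ 2)) / 2 := by gcongr
    _ = Real.pi / 2 * b := by field_simp

/-- At |u| = b the J₁ representation degenerates, so the bound is extended there by continuity.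
Aliases do reach this endpoint, when |ν| = τ. -/
theorem norm_windowIntegral_le {b u : ℝ} (hb : 0 ≤ b) (h : b ≤ |u|) :
    ‖windowIntegral b u‖ ≤ Real.pi / 2 * b := by
  have hclosed : IsClosed {u | ‖windowIntegral b u‖ ≤ Real.pi / 2 * b} :=
    isClosed_le (continuous_windowIntegral b).norm continuous_const
  rcases le_total 0 u with hu | hu
  · rw [abs_of_nonneg hu] at h
    have : closure (Ioi b) ⊆ {u | ‖windowIntegral b u‖ ≤ Real.pi / 2 * b} :=
      closure_minimal (fun w hw => norm_windowIntegral_le_of_lt hb (lt_of_lt_of_le hw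
        (le_abs_self w))) hclosed
    rw [closure_Ioi] at this
    exact this h
  · rw [abs_of_nonpos hu] at h
    have : closure (Iio (-b)) ⊆ {u | ‖windowIntegral b u‖ ≤ Real.pi / 2 * b} :=
      closure_minimal (fun w hw => norm_windowIntegral_le_of_lt hb
        (lt_of_lt_of_le (lt_neg.1 hw) (neg_le_abs w))) hclosed
    rw [closure_Iio] at this
    exact this (by simp; linarith)

/-- The decay y^{-3/2} is what makes the sum over aliases converge. -/
theorem norm_windowIntegral_le_of_sq {b u y : ℝ} (hb : 0 ≤ b) (hy : 1 ≤ y)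
    (h : b ^ 2 + y ^ 2 ≤ u ^ 2) :
    ‖windowIntegral b u‖ ≤ 4 * √2 / (y * √y) * b := by
  have hsq : 1 ≤ u ^ 2 - b ^ 2 := by nlinarith
  set w := √(u ^ 2 - b ^ 2) with hw
  have hyw : y ≤ w := Real.le_sqrt_of_sq_le (by linarith)
  obtain ⟨y', hy', h1⟩ := norm_windowIntegral_eq (u := u) (y := w) (by linarith) hb
    (by rw [hw, Real.sq_sqrt (by linarith)]; ring)
  have h2 := norm_besselIntegral_le_div_sqrt (y := y') (by rw [hy']; linarith)
  rw [hy'] at h2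
  rw [h1]
  have hy0 : 0 < y := by linarith
  calc _ ≤ b / w * (8 * √2 / √w) / 2 := by gcongr
    _ ≤ b / y * (8 * √2 / √y) / 2 := by gcongr
    _ = _ := by field_simp; ring

/-! ### Lower bounds below the threshold -/

/-- Each signed Taylor remainder vanishes at 0 and has the previous one as its derivative, so
nonnegativity propagates. -/
theorem one_sub_le_exp_neg {w : ℝ} (hw : 0 ≤ w) :
    1 - w + w ^ 2 / 2 - w ^ 3 / 6 ≤ Real.exp (-w) := by
  have key : ∀ f f' : ℝ → ℝ, (∀ x, HasDerivAt f (f' x) x) → (∀ x, 0 ≤ x → 0 ≤ f' x) → f 0 = 0 →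
      ∀ x, 0 ≤ x → 0 ≤ f x := by
    intro f f' hd hn h0 x hx
    rw [← h0]
    exact monotoneOn_of_hasDerivWithinAt_nonneg (convex_Ici 0)
      (fun y _ => (hd y).continuousAt.continuousWithinAt)
      (fun y _ => (hd y).hasDerivWithinAt)
      (fun y hy => hn y (by simpa using (interior_subset hy))) self_mem_Ici hx hx
  have he : ∀ x : ℝ, HasDerivAt (fun x : ℝ => Real.exp (-x)) (-Real.exp (-x)) x := fun x => by
    simpa using (hasDerivAt_neg x).exp
  have h1 := key (fun x => Real.exp (-x) - (1 - x)) (fun x => -Real.exp (-x) - (0 - 1))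
    (fun x => (he x).sub ((hasDerivAt_const x 1).sub (hasDerivAt_id x)))
    (fun x hx => by simpa using hx) (by simp)
  have h2 := key (fun x => 1 - x + x ^ 2 / 2 - Real.exp (-x))
    (fun x => 0 - 1 + (2 : ℕ) * x ^ (2 - 1) / 2 - -Real.exp (-x))
    (fun x => (((hasDerivAt_const x 1).sub (hasDerivAt_id x)).add
      ((hasDerivAt_pow 2 x).div_const 2)).sub (he x))
    (fun x hx => by have := h1 x hx; simp at this ⊢; linarith) (by simp)
  have h3 := key (fun x => Real.exp (-x) - (1 - x + x ^ 2 / 2 - x ^ 3 / 6))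
    (fun x => -Real.exp (-x) -
      (0 - 1 + (2 : ℕ) * x ^ (2 - 1) / 2 - (3 : ℕ) * x ^ (3 - 1) / 6))
    (fun x => (he x).sub ((((hasDerivAt_const x 1).sub (hasDerivAt_id x)).add
      ((hasDerivAt_pow 2 x).div_const 2)).sub ((hasDerivAt_pow 3 x).div_const 6)))
    (fun x hx => by have := h2 x hx; simp at this ⊢; linarith) (by simp) w hw
  linarith

/-- Lower bound for the window integral at frequency zero, that is for `π I₁(z)`. -/
theorem exp_div_sqrt_le_integral_sinh {z : ℝ} (hz : 5 ≤ z) :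
    Real.exp z / √z ≤ ∫ x in (-1 : ℝ)..1, Real.sinh (z * √(1 - x ^ 2)) := by
  have hz0 : 0 < z := by linarith
  set r := √z with hr
  have hr2 : r ^ 2 = z := Real.sq_sqrt hz0.le
  have hr0 : 0 < r := Real.sqrt_pos.2 hz0
  -- The mass of the integral sits at scale z^{-1/2}; only [-c, c] is kept, and there the integrand
  -- is bounded below through a polynomial.
  set c : ℝ := 7 / 5 / r with hc
  have hc0 : 0 < c := by positivity
  have hc2 : c ^ 2 = 49 / 25 / z := by rw [hc, div_pow, hr2]; norm_num
  have hc2le : c ^ 2 ≤ 49 / 125 := by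
    rw [hc2, div_le_iff₀ hz0]; linarith
  have hc1 : c ≤ 1 := by nlinarith
  have hcr : c * r = 7 / 5 := by rw [hc]; field_simp
  set p : ℝ → ℝ := fun x => 1 - (9 / 16 * z) * x ^ 2 + (9 / 16 * z) ^ 2 / 2 * x ^ 4 -
    (9 / 16 * z) ^ 3 / 6 * x ^ 6 with hp
  have hcont : Continuous fun x : ℝ => Real.sinh (z * √(1 - x ^ 2)) := by fun_prop
  have hpt : ∀ x ∈ Icc (-c) c, (Real.exp z * p x - 1) / 2 ≤ Real.sinh (z * √(1 - x ^ 2)) := by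
    intro x hx
    have hx2 : x ^ 2 ≤ c ^ 2 := sq_le_sq' hx.1 hx.2
    -- Valid for x² ≤ 32/81; here x² ≤ 49/125, just below.
    have hsq : 1 - 9 / 16 * x ^ 2 ≤ √(1 - x ^ 2) := by
      apply Real.le_sqrt_of_sq_le
      nlinarith [sq_nonneg x]
    have hw : 0 ≤ 9 / 16 * z * x ^ 2 := by positivity
    have he := one_sub_le_exp_neg hw
    have h1 : Real.exp z * p x ≤ Real.exp (z * √(1 - x ^ 2)) := by
      calc Real.exp z * p x ≤ Real.exp z * Real.exp (-(9 / 16 * z * x ^ 2)) := by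
            gcongr
            refine le_trans (le_of_eq ?_) he
            simp only [hp]; ring
        _ = Real.exp (z * (1 - 9 / 16 * x ^ 2)) := by rw [← Real.exp_add]; ring_nf
        _ ≤ _ := by gcongr
    have h2 : Real.exp (-(z * √(1 - x ^ 2))) ≤ 1 := by
      apply Real.exp_le_one_iff.2
      simp only [Left.neg_nonpos_iff]
      positivity
    rw [Real.sinh_eq]
    linarith
  have hnn : ∀ x : ℝ, 0 ≤ Real.sinh (z * √(1 - x ^ 2)) := fun x =>
    Real.sinh_nonneg_iff.2 (by positivity)
  have hmono : ∫ x in (-c)..c, Real.sinh (z * √(1 - x ^ 2)) ≤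
      ∫ x in (-1 : ℝ)..1, Real.sinh (z * √(1 - x ^ 2)) :=
    integral_mono_interval (by linarith) (by linarith) hc1 (Filter.Eventually.of_forall hnn)
      (hcont.intervalIntegrable _ _)
  have hpint : ∫ x in (-c)..c, (Real.exp z * p x - 1) / 2 =
      Real.exp z * (c - (9 / 16 * z) * (c ^ 3 / 3) + (9 / 16 * z) ^ 2 / 2 * (c ^ 5 / 5) -
        (9 / 16 * z) ^ 3 / 6 * (c ^ 7 / 7)) - c := by
    have hd : ∀ x : ℝ, HasDerivAt (fun x : ℝ => (Real.exp z * (x - (9 / 16 * z) * (x ^ 3 / 3) +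
        (9 / 16 * z) ^ 2 / 2 * (x ^ 5 / 5) - (9 / 16 * z) ^ 3 / 6 * (x ^ 7 / 7)) - x) / 2)
        ((Real.exp z * p x - 1) / 2) x := by
      intro x
      have := ((((((hasDerivAt_id x).sub (((hasDerivAt_pow 3 x).div_const 3).const_mul
        (9 / 16 * z))).add (((hasDerivAt_pow 5 x).div_const 5).const_mul
        ((9 / 16 * z) ^ 2 / 2))).sub (((hasDerivAt_pow 7 x).div_const 7).const_mul
        ((9 / 16 * z) ^ 3 / 6))).const_mul (Real.exp z)).sub (hasDerivAt_id x)).div_const 2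
      refine this.congr_deriv ?_
      simp only [hp]
      push_cast
      ring
    rw [integral_eq_sub_of_hasDerivAt (fun x _ => hd x)
      (Continuous.intervalIntegrable (by fun_prop) _ _)]
    ring
  have hlow : ∫ x in (-c)..c, (Real.exp z * p x - 1) / 2 ≤
      ∫ x in (-c)..c, Real.sinh (z * √(1 - x ^ 2)) :=
    integral_mono_on (by linarith) (Continuous.intervalIntegrable (by fun_prop) _ _)
      (hcont.intervalIntegrable _ _) hpt
  have hval : c - (9 / 16 * z) * (c ^ 3 / 3) + (9 / 16 * z) ^ 2 / 2 * (c ^ 5 / 5) -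
        (9 / 16 * z) ^ 3 / 6 * (c ^ 7 / 7) = c * (1 - 9 / 16 * (49 / 25) / 3 +
          (9 / 16 * (49 / 25)) ^ 2 / 10 - (9 / 16 * (49 / 25)) ^ 3 / 42) := by
    have : z * c ^ 2 = 49 / 25 := by rw [hc2]; field_simp
    rw [← this]; ring
  -- After multiplication by √z the bound is about 1.011 e^z - 7/5; the small surplus absorbs 7/5
  -- once e^z ≥ 140, hence z ≥ 5.
  have hexp : 140 ≤ Real.exp z := by
    have h5 : Real.exp 5 ≤ Real.exp z := Real.exp_le_exp.2 hz
    have h1 : (2.7 : ℝ) ≤ Real.exp 1 := by linarith [Real.exp_one_gt_d9]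
    have : (2.7 : ℝ) ^ 5 ≤ Real.exp 1 ^ 5 := by gcongr
    rw [← Real.exp_nat_mul] at this
    norm_num at this
    linarith
  rw [hpint, hval] at hlow
  refine le_trans ?_ (hlow.trans hmono)
  rw [div_le_iff₀ hr0, sub_mul, mul_assoc, mul_right_comm c, hcr]
  norm_num
  nlinarith

theorem exp_div_sqrt_le_norm_windowIntegral {z : ℝ} (hz : 5 ≤ z) :
    Real.exp z / √z ≤ ‖windowIntegral z 0‖ := by
  have : windowIntegral z 0 = ((∫ x in (-1 : ℝ)..1, Real.sinh (z * √(1 - x ^ 2)) : ℝ) : ℂ) := by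
    rw [windowIntegral, ← intervalIntegral.integral_ofReal]
    simp
  rw [this, norm_real]
  exact (exp_div_sqrt_le_integral_sinh hz).trans (le_abs_self _)

/-- Both w/z and √(w/z) are at most e^{(w-z)/2}, because w/z ≤ 1 + (w-z)/2 for z ≥ 2. -/
theorem exp_div_mul_sqrt_mono {z w : ℝ} (hz : 5 ≤ z) (hzw : z ≤ w) :
    Real.exp z / (z * √z) ≤ Real.exp w / (w * √w) := by
  have hz0 : 0 < z := by linarith
  have hw0 : 0 < w := by linarith
  have h1 : w / z ≤ Real.exp ((w - z) / 2) := by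
    refine le_trans ?_ (Real.add_one_le_exp _)
    rw [div_le_iff₀ hz0]
    nlinarith
  have h2 : √w / √z ≤ Real.exp ((w - z) / 2) := by
    refine le_trans ?_ h1
    rw [← Real.sqrt_div hw0.le]
    rw [Real.sqrt_le_left (by positivity), sq]
    exact le_mul_of_one_le_left (by positivity) ((one_le_div hz0).2 hzw)
  have h3 : (w / z) * (√w / √z) ≤ Real.exp (w - z) := by
    calc _ ≤ Real.exp ((w - z) / 2) * Real.exp ((w - z) / 2) := by gcongr
      _ = _ := by rw [← Real.exp_add]; ring_nf
  have hsz : 0 < √z := Real.sqrt_pos.2 hz0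
  have hsw : 0 < √w := Real.sqrt_pos.2 hw0
  rw [Real.exp_sub, div_mul_div_comm, div_le_div_iff₀ (by positivity) (Real.exp_pos z)] at h3
  rw [div_le_div_iff₀ (by positivity) (by positivity)]
  linarith

/-- Lower bound for the Fourier integral of the sinh window below the threshold. -/
theorem le_norm_windowIntegral {b u z : ℝ} (hb : 0 ≤ b) (hz : 5 ≤ z) (h : u ^ 2 + z ^ 2 ≤ b ^ 2) :
    b * (Real.exp z / (z * √z)) ≤ ‖windowIntegral b u‖ := by
  set w := √(b ^ 2 - u ^ 2) with hw
  have hw2 : w ^ 2 = b ^ 2 - u ^ 2 := Real.sq_sqrt (by nlinarith)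
  have hzw : z ≤ w := Real.le_sqrt_of_sq_le (by linarith)
  have hw0 : 0 < w := by linarith
  have key := angularIntegral_cosh_sinh w (Real.arsinh (u / w))
  have hc : Real.cosh (Real.arsinh (u / w)) = b / w := by
    rw [Real.cosh_arsinh, ← Real.sqrt_sq (show 0 ≤ b / w by positivity)]
    congr 1
    rw [div_pow, div_pow, show b ^ 2 = w ^ 2 + u ^ 2 by linarith]
    field_simp
  rw [hc, Real.sinh_arsinh, mul_div_cancel₀ _ hw0.ne', mul_div_cancel₀ _ hw0.ne',
    ← two_mul_windowIntegral, ← two_mul_windowIntegral, mul_left_comm] at key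
  rw [mul_left_cancel₀ two_ne_zero key, norm_mul, norm_real, Real.norm_eq_abs,
    abs_of_nonneg (by positivity)]
  calc b * (Real.exp z / (z * √z)) ≤ b * (Real.exp w / (w * √w)) := by
        gcongr ?_ * ?_
        exact exp_div_mul_sqrt_mono hz hzw
    _ = b / w * (Real.exp w / √w) := by field_simp
    _ ≤ _ := by
        gcongr
        exact exp_div_sqrt_le_norm_windowIntegral (hz.trans hzw)

/-! ### Sums over aliased frequencies -/

/-- The terms r = ±1 stay separate because the nearest aliases need individual estimates; bounded
partial sums of b handle the tails. -/
theorem summable_int_and_norm_tsum_sub_le {f : ℤ → ℂ} {b : ℕ → ℝ} {B : ℝ}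
    (hB : ∀ n, ∑ i ∈ Finset.range n, b i ≤ B)
    (hpos : ∀ n : ℕ, ‖f (n + 2)‖ ≤ b n) (hneg : ∀ n : ℕ, ‖f (-(n + 2))‖ ≤ b n) :
    Summable f ∧ ‖∑' r, f r - f 0‖ ≤ ‖f 1‖ + ‖f (-1)‖ + 2 * B := by
  have hb0 : ∀ n, 0 ≤ b n := fun n => (norm_nonneg _).trans (hpos n)
  have hbs : Summable b := summable_of_sum_range_le hb0 hB
  have hbB : ∑' n, b n ≤ B := hbs.tsum_le_of_sum_range_le hB
  have hp2 : Summable fun n : ℕ => f ((n + 2 : ℕ) : ℤ) :=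
    Summable.of_norm_bounded hbs (fun n => by push_cast; exact hpos n)
  have hn2 : Summable fun n : ℕ => f (-((n + 2 : ℕ) : ℤ)) :=
    Summable.of_norm_bounded hbs (fun n => by push_cast; exact hneg n)
  have hp : Summable fun n : ℕ => f (n : ℤ) := (summable_nat_add_iff 2).1 hp2
  have hn : Summable fun n : ℕ => f (-(n : ℤ)) :=
    (summable_nat_add_iff (f := fun n : ℕ => f (-(n : ℤ))) 2).1 hn2
  refine ⟨Summable.of_nat_of_neg hp hn, ?_⟩
  have h1 : ‖∑' n : ℕ, f ((n + 2 : ℕ) : ℤ)‖ ≤ ∑' n, b n :=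
    tsum_of_norm_bounded hbs.hasSum (fun n => by push_cast; exact hpos n)
  have h2 : ‖∑' n : ℕ, f (-((n + 2 : ℕ) : ℤ))‖ ≤ ∑' n, b n :=
    tsum_of_norm_bounded hbs.hasSum (fun n => by push_cast; exact hneg n)
  have e1 := hp.sum_add_tsum_nat_add 2
  have e2 := hn.sum_add_tsum_nat_add 2
  simp only [Finset.sum_range_succ, Finset.sum_range_zero, Nat.cast_zero, Nat.cast_one, zero_add,
    neg_zero] at e1 e2
  rw [Summable.tsum_of_nat_of_neg hp hn, ← e1, ← e2]
  have : f 0 + f 1 + ∑' n : ℕ, f ((n + 2 : ℕ) : ℤ) +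
      (f 0 + f (-1) + ∑' n : ℕ, f (-((n + 2 : ℕ) : ℤ))) - f 0 - f 0 =
      f 1 + f (-1) + (∑' n : ℕ, f ((n + 2 : ℕ) : ℤ) + ∑' n : ℕ, f (-((n + 2 : ℕ) : ℤ))) := by ring
  rw [this]
  refine (norm_add_le _ _).trans ?_
  have h3 := norm_add_le (f 1) (f (-1))
  have h4 := norm_add_le (∑' n : ℕ, f ((n + 2 : ℕ) : ℤ)) (∑' n : ℕ, f (-((n + 2 : ℕ) : ℤ)))
  linarith

/-- This is the midpoint inequality for the convex function q^{-3/2} on an interval of length 1, in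
a form that telescopes. -/
theorem inv_mul_sqrt_le_telescope {q : ℝ} (hq : 1 / 2 < q) :
    1 / (q * √q) ≤ 2 * (1 / √(q - 1 / 2) - 1 / √(q + 1 / 2)) := by
  set a := √(q - 1 / 2) with ha
  set b := √(q + 1 / 2) with hb
  set s := √q with hs
  have ha0 : 0 < a := Real.sqrt_pos.2 (by linarith)
  have hb0 : 0 < b := Real.sqrt_pos.2 (by linarith)
  have hs0 : 0 < s := Real.sqrt_pos.2 (by linarith)
  have ha2 : a ^ 2 = q - 1 / 2 := Real.sq_sqrt (by linarith)
  have hb2 : b ^ 2 = q + 1 / 2 := Real.sq_sqrt (by linarith)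
  have hs2 : s ^ 2 = q := Real.sq_sqrt (by linarith)
  have hab : a * b ≤ q := by nlinarith [sq_nonneg (a - b)]
  have hsum : a + b ≤ 2 * s := by
    refine (abs_le_of_sq_le_sq' ?_ (by positivity)).2
    nlinarith [sq_nonneg (a - b)]
  have e : 2 * (1 / a - 1 / b) = 2 / (a * b * (a + b)) := by
    field_simp
    nlinarith
  rw [e, div_le_div_iff₀ (by positivity) (by positivity)]
  have : a * b * (a + b) ≤ q * (2 * s) := by gcongr
  linarith

/-- The sinh-window Fourier integrals at the aliased frequencies are small. -/
theorem aliasing_bound {m τ ν C : ℝ} (hm : 2 ≤ m) (hτ : τ ∈ Icc (1 / 4 : ℝ) (2 / 5))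
    (hν : |ν| ≤ τ) (hC : 0 ≤ C) {f : ℤ → ℂ}
    (hf : ∀ r : ℤ, ‖f r‖ = C *
      ‖windowIntegral (2 * Real.pi * m * (1 - τ)) (-(2 * Real.pi * m * (ν + r)))‖) :
    Summable f ∧ ‖∑' r, f r - f 0‖ ≤ C * (5 / 2 * (2 * Real.pi * m * (1 - τ))) := by
  obtain ⟨hτ1, hτ2⟩ := hτ
  obtain ⟨hν1, hν2⟩ := abs_le.1 hν
  have hpi := Real.pi_gt_d2
  have hpi' := Real.pi_lt_d2
  set K := 2 * Real.pi * m with hK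
  have hK1 : 12.56 ≤ K := by rw [hK]; nlinarith
  have hK0 : 0 < K := by linarith
  have hb : 0 ≤ K * (1 - τ) := mul_nonneg hK0.le (by linarith)
  set D := 4 * √2 / (K * √K) with hD
  have hsq2 : √2 ≤ 1.415 := by rw [Real.sqrt_le_left (by norm_num)]; norm_num
  have hsqK : 3.54 ≤ √K := Real.le_sqrt_of_sq_le (by norm_num at hK1 ⊢; linarith)
  have hD0 : 0 ≤ D := by positivity
  have hD1 : D ≤ 0.1275 := by
    rw [hD, div_le_iff₀ (by positivity)]
    have : 12.56 * 3.54 ≤ K * √K := by gcongr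
    linarith
  have hfar : ∀ (r : ℤ) (q : ℝ), 1 ≤ K * q → (1 - τ) ^ 2 + q ^ 2 ≤ (ν + r) ^ 2 →
      ‖f r‖ ≤ C * (K * (1 - τ)) * (D * (1 / (q * √q))) := by
    intro r q hq h
    have h1 := norm_windowIntegral_le_of_sq (u := -(K * (ν + r))) hb hq (by
      have := mul_le_mul_of_nonneg_left h (sq_nonneg K)
      linarith)
    rw [hf r, mul_assoc C]
    gcongr
    refine h1.trans (le_of_eq ?_)
    rw [Real.sqrt_mul hK0.le, hD]
    have hq0 : 0 < q := pos_of_mul_pos_right (by linarith) hK0.le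
    field_simp
  have hnear : ∀ r : ℤ, (1 - τ) ≤ |ν + r| → ‖f r‖ ≤ C * (K * (1 - τ)) * (Real.pi / 2) := by
    intro r h
    have h1 := norm_windowIntegral_le (u := -(K * (ν + r))) hb
      (by rw [abs_neg, abs_mul, abs_of_pos hK0]; gcongr)
    rw [hf r, mul_assoc C, mul_comm _ (Real.pi / 2)]
    gcongr
  have htail : ∀ (n : ℕ) (r : ℤ), ((n : ℝ) + 2 - τ) ^ 2 ≤ (ν + r) ^ 2 → ‖f r‖ ≤
      C * (K * (1 - τ)) * (D * (2 * (1 / √((n : ℝ) + 3 / 4) - 1 / √((n + 1 : ℕ) + 3 / 4)))) := by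
    intro n r h
    have hn : (0 : ℝ) ≤ n := n.cast_nonneg
    -- For τ ≤ 2/5, (n+2-τ)² - (1-τ)² = (n+1)(n+3-2τ) ≥ (n+5/4)².
    refine (hfar r (n + 5 / 4) (by nlinarith) (by nlinarith)).trans ?_
    have := inv_mul_sqrt_le_telescope (q := (n : ℝ) + 5 / 4) (by linarith)
    rw [show (n : ℝ) + 5 / 4 - 1 / 2 = n + 3 / 4 by ring,
      show (n : ℝ) + 5 / 4 + 1 / 2 = (n + 1 : ℕ) + 3 / 4 by push_cast; ring] at this
    gcongr
  have hB : ∀ n : ℕ, ∑ i ∈ Finset.range n, C * (K * (1 - τ)) *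
      (D * (2 * (1 / √((i : ℝ) + 3 / 4) - 1 / √((i + 1 : ℕ) + 3 / 4)))) ≤
      C * (K * (1 - τ)) * (D * (2 * 1.16)) := by
    intro n
    rw [← Finset.mul_sum, ← Finset.mul_sum, ← Finset.mul_sum,
      Finset.sum_range_sub' (fun i : ℕ => 1 / √((i : ℝ) + 3 / 4))]
    gcongr
    have h1 : 0 ≤ 1 / √((n : ℝ) + 3 / 4) := by positivity
    have h2 : 1 / √(((0 : ℕ) : ℝ) + 3 / 4) ≤ 1.16 := by
      rw [div_le_iff₀ (by positivity)]
      have : 0.866 ≤ √(((0 : ℕ) : ℝ) + 3 / 4) := Real.le_sqrt_of_sq_le (by norm_num)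
      linarith
    linarith
  obtain ⟨hs, hle⟩ := summable_int_and_norm_tsum_sub_le hB
    (fun n => htail n (n + 2) (by
      have hn : (0 : ℝ) ≤ n := n.cast_nonneg
      push_cast
      exact pow_le_pow_left₀ (by linarith) (by linarith) 2))
    (fun n => htail n (-(n + 2)) (by
      have hn : (0 : ℝ) ≤ n := n.cast_nonneg
      push_cast
      rw [← neg_sq (ν + _)]
      exact pow_le_pow_left₀ (by linarith) (by linarith) 2))
  refine ⟨hs, hle.trans ?_⟩
  -- One of r = ±1 may lie on the threshold and gets only π/2. The other has |ν + r| ≥ 1, and 1 -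
  -- (1-τ)² ≥ 7/16 > 0.66² since τ ≥ 1/4.
  have hone : ‖f 1‖ + ‖f (-1)‖ ≤ C * (K * (1 - τ)) * (Real.pi / 2 + D * 1.87) := by
    have hw : 1 / (0.66 * √0.66) ≤ (1.87 : ℝ) := by
      rw [div_le_iff₀ (by positivity)]
      have : (0.8124 : ℝ) ≤ √0.66 := Real.le_sqrt_of_sq_le (by norm_num)
      linarith
    have hq : 1 ≤ K * 0.66 := by linarith
    have hCb : 0 ≤ C * (K * (1 - τ)) := by positivity
    rcases le_total 0 ν with h | h
    · have h1 := hfar 1 0.66 hq (by push_cast; nlinarith)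
      have h2 := hnear (-1) (by push_cast; rw [abs_of_nonpos (by linarith)]; linarith)
      have h3 : C * (K * (1 - τ)) * (D * (1 / (0.66 * √0.66))) ≤ C * (K * (1 - τ)) * (D * 1.87) := by
        gcongr
      linarith
    · have h1 := hfar (-1) 0.66 hq (by push_cast; nlinarith)
      have h2 := hnear 1 (by push_cast; rw [abs_of_nonneg (by linarith)]; linarith)
      have h3 : C * (K * (1 - τ)) * (D * (1 / (0.66 * √0.66))) ≤ C * (K * (1 - τ)) * (D * 1.87) := by
        gcongr
      linarith
  have hlast : C * (K * (1 - τ)) * (Real.pi / 2 + D * 1.87 + 2 * (D * (2 * 1.16))) ≤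
      C * (K * (1 - τ)) * (5 / 2) := by
    gcongr
    linarith
  linarith

/-- Size of the exponent `2πm √(1 - 2τ)` and the lower bound for the Fourier integral of the sinh
window at low frequencies in terms of it. -/
theorem low_frequency_bounds {m τ ν : ℝ} (hm : 2 ≤ m)
    (hτ : τ ∈ Icc (1 / 4 : ℝ) (2 / 5)) (hν : |ν| ≤ τ) :
    5 ≤ 2 * Real.pi * m * √(1 - 2 * τ) ∧ 2 * Real.pi * m * √(1 - 2 * τ) ≤ 4.46 * m ∧
    2 * Real.pi * m * (1 - τ) * (Real.exp (2 * Real.pi * m * √(1 - 2 * τ)) /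
      (2 * Real.pi * m * √(1 - 2 * τ) * √(2 * Real.pi * m * √(1 - 2 * τ)))) ≤
        ‖windowIntegral (2 * Real.pi * m * (1 - τ)) (-(2 * Real.pi * m * ν))‖ := by
  obtain ⟨hτ1, hτ2⟩ := hτ
  have hpi := Real.pi_gt_d2
  have hpi' := Real.pi_lt_d2
  set K := 2 * Real.pi * m with hK
  have hK1 : 12.56 ≤ K := by rw [hK]; nlinarith
  have hK0 : 0 < K := by linarith
  have hb : 0 ≤ K * (1 - τ) := mul_nonneg hK0.le (by linarith)
  set z := K * √(1 - 2 * τ) with hz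
  have hz2 : z ^ 2 = K ^ 2 * (1 - 2 * τ) := by
    rw [hz, mul_pow, Real.sq_sqrt (by linarith)]
  have hs : 0.44 ≤ √(1 - 2 * τ) := Real.le_sqrt_of_sq_le (by norm_num; linarith)
  have hz5 : 5 ≤ z := by rw [hz]; nlinarith
  have hsqν : ν ^ 2 ≤ τ ^ 2 := by rw [← sq_abs ν]; gcongr
  -- (1-τ)² - τ² = 1 - 2τ is where the exponent comes from.
  refine ⟨hz5, ?_, le_norm_windowIntegral hb hz5 (by rw [hz2]; nlinarith [sq_nonneg K])⟩
  refine (abs_le_of_sq_le_sq' ?_ (by positivity)).2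
  have hK2 : K ≤ 6.3 * m := by rw [hK]; nlinarith
  calc z ^ 2 ≤ (6.3 * m) ^ 2 * (1 / 2) := by
        rw [hz2]
        gcongr
        · linarith
        · linarith
    _ ≤ (4.46 * m) ^ 2 := by nlinarith [sq_nonneg m]

/-- The aliasing bound is a small fraction of the Fourier integral at a low frequency. -/
theorem aliasing_le_mul_norm_windowIntegral {m τ ν : ℝ} (hm : 2 ≤ m)
    (hτ : τ ∈ Icc (1 / 4 : ℝ) (2 / 5)) (hν : |ν| ≤ τ) :
    5 / 2 * (2 * Real.pi * m * (1 - τ)) ≤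
      (24 * m ^ (3 / 2 : ℝ) + 10) * Real.exp (-2 * Real.pi * m * √(1 - 2 * τ)) *
        ‖windowIntegral (2 * Real.pi * m * (1 - τ)) (-(2 * Real.pi * m * ν))‖ := by
  obtain ⟨hz5, hzm, hV⟩ := low_frequency_bounds hm hτ hν
  rw [show -2 * Real.pi * m * √(1 - 2 * τ) = -(2 * Real.pi * m * √(1 - 2 * τ)) by ring]
  set z := 2 * Real.pi * m * √(1 - 2 * τ)
  set b := 2 * Real.pi * m * (1 - τ)
  have hz0 : 0 < z := by linarith
  have hb0 : 0 ≤ b := by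
    have := hτ.2
    exact mul_nonneg (by positivity) (by linarith)
  have hsz : √z ≤ 2.12 * √m := by
    rw [Real.sqrt_le_left (by positivity), mul_pow, Real.sq_sqrt (by linarith)]
    linarith
  have hzz : z * √z ≤ 4.46 * m * (2.12 * √m) := by gcongr
  have hm32 : m ^ (3 / 2 : ℝ) = m * √m := by
    rw [Real.sqrt_eq_rpow, ← Real.rpow_one_add' (by linarith) (by norm_num)]
    norm_num
  have hmm : 0 < m * √m := by positivity
  rw [hm32]
  -- 5/2 · 4.46 · 2.12 < 24 gives the constant 24; the summand 10 is slack.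
  calc 5 / 2 * b = (5 / 2 * (z * √z)) * Real.exp (-z) * (b * (Real.exp z / (z * √z))) := by
        rw [Real.exp_neg]; field_simp
    _ ≤ (24 * (m * √m) + 10) * Real.exp (-z) * ‖windowIntegral b (-(2 * Real.pi * m * ν))‖ := by
        gcongr
        linarith

/-! ### The window, its transform and Poisson summation -/

/-- Outside [-1, 1] the real square root is 0, so one formula covers all x and continuity is
immediate. -/
theorem omegaSinh_eq (β x : ℝ) :
    omegaSinh β x = Real.sinh (β * √(1 - x ^ 2)) / Real.sinh β := by
  unfold omegaSinh
  split_ifs with h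
  · rfl
  · have : 1 - x ^ 2 ≤ 0 := by
      rw [mem_Icc, ← abs_le, not_le] at h
      have := (sq_lt_sq₀ zero_le_one (abs_nonneg x)).2 h
      rw [sq_abs] at this
      linarith
    simp [Real.sqrt_eq_zero_of_nonpos this]

theorem continuous_phiSinh (m : ℕ) (σ : ℝ) (L : ℕ) : Continuous (phiSinh m σ L) := by
  unfold phiSinh
  simp only [omegaSinh_eq]
  fun_prop

theorem phiSinh_neg (m : ℕ) (σ : ℝ) (L : ℕ) (t : ℝ) : phiSinh m σ L (-t) = phiSinh m σ L t := by
  simp only [phiSinh, omegaSinh_eq, mul_neg, neg_div, neg_sq]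

theorem omegaSinh_eq_zero {β x : ℝ} (h : 1 ≤ |x|) : omegaSinh β x = 0 := by
  have : 1 - x ^ 2 ≤ 0 := by
    rw [← sq_abs]
    nlinarith
  simp [omegaSinh_eq, Real.sqrt_eq_zero_of_nonpos this]

theorem phiSinh_eq_zero {m L : ℕ} (hm : 0 < m) {σ t : ℝ} (h : (m : ℝ) ≤ |L * t|) :
    phiSinh m σ L t = 0 := by
  refine omegaSinh_eq_zero ?_
  have hm' : (0 : ℝ) < m := Nat.cast_pos.2 hm
  rwa [abs_div, abs_of_pos hm', one_le_div hm']

/-- The phase `e^{-2π i x}`. -/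
noncomputable def phase (x : ℝ) : ℂ := exp (-2 * (Real.pi : ℂ) * I * (x : ℝ))

theorem phase_add (x y : ℝ) : phase (x + y) = phase x * phase y := by
  rw [phase, phase, phase, ← exp_add]
  push_cast
  ring_nf

theorem norm_phase (x : ℝ) : ‖phase x‖ = 1 := by
  rw [phase, show -2 * (Real.pi : ℂ) * I * (x : ℝ) = ((-2 * Real.pi * x : ℝ) : ℂ) * I by
    push_cast; ring]
  exact norm_exp_ofReal_mul_I _

theorem continuous_phase : Continuous phase := by
  unfold phase
  fun_prop

theorem fourier_eq_integral_phase (f : ℝ → ℂ) (v : ℝ) : 𝓕 f v = ∫ t, phase (t * v) * f t := by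
  rw [Real.fourier_real_eq_integral_exp_smul]
  refine integral_congr_ae (Filter.Eventually.of_forall fun t => ?_)
  simp only [smul_eq_mul, phase]
  congr 2
  push_cast
  ring

/-- The Fourier transform of the sinh-type window. -/
theorem hat_phiSinh {m L : ℕ} (hm : 0 < m) (hL : 0 < L) (σ v : ℝ) :
    hat (phiSinh m σ L) v = ((m / (L * Real.sinh (shapeParam m σ)) : ℝ) : ℂ) *
      windowIntegral (shapeParam m σ) (-(2 * Real.pi * m * (v / L))) := by
  have hm' : (0 : ℝ) < m := Nat.cast_pos.2 hm
  have hL' : (0 : ℝ) < L := Nat.cast_pos.2 hL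
  set β := shapeParam m σ
  set g : ℝ → ℂ := fun x => phase (m / L * x * v) * (omegaSinh β x : ℂ) with hg
  have h1 : hat (phiSinh m σ L) v = ∫ t : ℝ, g (L / m * t) := by
    rw [hat, fourier_eq_integral_phase]
    refine integral_congr_ae (Filter.Eventually.of_forall fun t => ?_)
    simp only [hg, phiSinh]
    congr 2
    · congr 1
      field_simp
    · congr 1
      ring
  have h2 : ∫ x, g x = ∫ x in (-1 : ℝ)..1, g x := by
    refine (integral_eq_integral_of_support_subset fun x hx => ?_).symm
    have : ¬ 1 ≤ |x| := fun h => hx (by simp [hg, omegaSinh_eq_zero h])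
    rw [not_le, abs_lt] at this
    exact ⟨this.1, this.2.le⟩
  rw [h1, Measure.integral_comp_mul_left, h2, abs_of_pos (by positivity), windowIntegral,
    inv_div, real_smul, ← intervalIntegral.integral_const_mul, ← intervalIntegral.integral_const_mul]
  refine integral_congr fun x _ => ?_
  simp only [hg, omegaSinh_eq, phase]
  rw [show -2 * (Real.pi : ℂ) * I * ((m / L * x * v : ℝ) : ℂ) =
    ((-(2 * Real.pi * m * (v / L)) * x : ℝ) : ℂ) * I by push_cast; ring]
  push_cast
  field_simp

/-- This is the input to Poisson summation: integer samples of this function are the terms of the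
window sum, and its transform at r is the alias w + rL. Substitute y = x/L - t. -/
theorem fourier_modulated_window (φ : ℝ → ℝ) {L : ℝ} (hL : 0 < L) (t w r : ℝ) :
    𝓕 (fun x : ℝ => (φ (x / L - t) : ℂ) * phase (x * w / L)) r =
      L * (hat φ (w + r * L) * phase (t * (w + r * L))) := by
  have h1 : 𝓕 (fun x : ℝ => (φ (x / L - t) : ℂ) * phase (x * w / L)) r =
      ∫ x : ℝ, (fun s : ℝ => (fun y : ℝ => phase ((y + t) * (w + r * L)) * (φ y : ℂ)) (s - t))
        (x / L) := by
    rw [fourier_eq_integral_phase]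
    refine integral_congr_ae (Filter.Eventually.of_forall fun x => ?_)
    simp only
    rw [show (x / L - t + t) * (w + r * L) = x * r + x * w / L by field_simp; ring, phase_add]
    ring
  rw [h1, Measure.integral_comp_div (fun s : ℝ => (fun y : ℝ =>
    phase ((y + t) * (w + r * L)) * (φ y : ℂ)) (s - t)), integral_sub_right_eq_self (μ := volume)
    (fun y : ℝ => phase ((y + t) * (w + r * L)) * (φ y : ℂ)) t, abs_of_pos hL, real_smul, hat,
    fourier_eq_integral_phase, ← MeasureTheory.integral_mul_const]
  congr 1
  refine integral_congr_ae (Filter.Eventually.of_forall fun x => ?_)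
  simp only [add_mul, phase_add]
  ring

theorem shapeParam_eq (m : ℕ) (σ : ℝ) :
    shapeParam m σ = 2 * Real.pi * m * (1 - 1 / (2 * σ)) := rfl

theorem half_inv_mem {σ : ℝ} (hσ : σ ∈ Icc (5 / 4 : ℝ) 2) :
    1 / (2 * σ) ∈ Icc (1 / 4 : ℝ) (2 / 5) := by
  obtain ⟨h1, h2⟩ := hσ
  constructor
  · exact one_div_le_one_div_of_le (by linarith) (by linarith)
  · rw [div_le_div_iff₀ (by linarith) (by norm_num)]
    linarith

theorem shapeParam_ge {m : ℕ} (hm : 2 ≤ m) {σ : ℝ} (hσ : σ ∈ Icc (5 / 4 : ℝ) 2) :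
    7.5 ≤ shapeParam m σ := by
  have h := (half_inv_mem hσ).2
  have hm' : (2 : ℝ) ≤ m := by exact_mod_cast hm
  have hpi := Real.pi_gt_d2
  rw [shapeParam_eq]
  have : 12.56 ≤ 2 * Real.pi * m := by nlinarith
  nlinarith

theorem abs_div_le_half_inv {L : ℕ} (hL : 0 < L) {σ w : ℝ}
    (hw : |w| ≤ L / (2 * σ)) : |w / L| ≤ 1 / (2 * σ) := by
  have hL' : (0 : ℝ) < L := Nat.cast_pos.2 hL
  rw [abs_div, abs_of_pos hL', div_le_iff₀ hL']
  exact hw.trans (le_of_eq (by ring))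

/-- Relative error factor of one sinh-type window. -/
noncomputable def windowError (m : ℕ) (σ : ℝ) : ℝ :=
  (24 * (m : ℝ) ^ (3 / 2 : ℝ) + 10) * Real.exp (-2 * Real.pi * m * √(1 - 1 / σ))

/-- Approximation of an exponential by a regular sum of translated windows. -/
theorem norm_window_sum_sub_le {m L : ℕ} (hm : 2 ≤ m) (hL : 0 < L) {σ : ℝ}
    (hσ : σ ∈ Icc (5 / 4 : ℝ) 2) {w : ℝ} (hw : |w| ≤ L / (2 * σ)) (t : ℝ) :
    ‖1 / (L : ℂ) * (∑' l : ℤ, (phiSinh m σ L (l / L - t) : ℂ) * phase (l * w / L)) -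
      hat (phiSinh m σ L) w * phase (t * w)‖ ≤ windowError m σ * ‖hat (phiSinh m σ L) w‖ := by
  have hm0 : 0 < m := by omega
  have hm' : (2 : ℝ) ≤ m := by exact_mod_cast hm
  have hL' : (0 : ℝ) < L := Nat.cast_pos.2 hL
  have hβ := shapeParam_ge hm hσ
  have hsinh : 0 < Real.sinh (shapeParam m σ) := Real.sinh_pos_iff.2 (by linarith)
  have hν := abs_div_le_half_inv hL hw
  set φ := phiSinh m σ L with hφ
  set C : ℝ := m / (L * Real.sinh (shapeParam m σ)) with hC
  have hC0 : 0 ≤ C := by positivity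
  set a : ℤ → ℂ := fun r => hat φ (w + r * L) * phase (t * (w + r * L)) with ha
  have hnorm : ∀ v, ‖hat φ v‖ =
      C * ‖windowIntegral (shapeParam m σ) (-(2 * Real.pi * m * (v / L)))‖ := by
    intro v
    rw [hφ, hat_phiSinh hm0 hL, norm_mul, norm_real, Real.norm_eq_abs, abs_of_nonneg hC0]
  obtain ⟨hsum, hbound⟩ := aliasing_bound (f := a) hm' (half_inv_mem hσ) hν hC0 (fun r => by
    rw [ha]
    simp only
    rw [norm_mul, norm_phase, mul_one, hnorm, shapeParam_eq,
      show (w + r * L) / L = w / L + r by field_simp])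
  set g : ℝ → ℂ := fun x => (φ (x / L - t) : ℂ) * phase (x * w / L) with hg
  have hgF : ∀ r : ℤ, 𝓕 g r = L * a r := fun r => fourier_modulated_window φ hL' t w r
  have hgc : Continuous g := by
    have h1 := continuous_phiSinh m σ L
    have h2 := continuous_phase
    rw [hg]
    fun_prop
  have hg0 : g =ᶠ[Filter.cocompact ℝ] fun _ => (0 : ℂ) := by
    filter_upwards [(isCompact_Icc (a := L * t - m) (b := L * t + m)).compl_mem_cocompact] with x hx
    have : (m : ℝ) ≤ |(L : ℝ) * (x / L - t)| := by
      rw [mul_sub, mul_div_cancel₀ _ hL'.ne']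
      by_contra hlt
      rw [not_le, abs_lt] at hlt
      exact hx ⟨by linarith, by linarith⟩
    simp [hg, hφ, phiSinh_eq_zero hm0 this]
  -- Decay is trivial by compact support; summability of the transform is the aliasing bound.
  have hpois := Real.tsum_eq_tsum_fourier_of_rpow_decay_of_summable hgc one_lt_two
    (hg0.isBigO.trans (Asymptotics.isBigO_zero _ _))
    (by simp only [hgF]; exact hsum.mul_left _) 0
  simp only [zero_add, hgF] at hpois
  have hpois' : ∑' l : ℤ, g l = L * ∑' r : ℤ, a r := by
    rw [hpois, ← tsum_mul_left]
    refine tsum_congr fun r => ?_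
    rw [show ((0 : ℝ) : UnitAddCircle) = 0 from rfl, fourier_eval_zero, mul_one]
  have hLC : (L : ℂ) ≠ 0 := Nat.cast_ne_zero.2 hL.ne'
  have hgoal : 1 / (L : ℂ) * (∑' l : ℤ, (φ (l / L - t) : ℂ) * phase (l * w / L)) -
      hat φ w * phase (t * w) = ∑' r, a r - a 0 := by
    have : ∑' l : ℤ, (φ (l / L - t) : ℂ) * phase (l * w / L) = ∑' l : ℤ, g l := rfl
    rw [this, hpois', one_div, inv_mul_cancel_left₀ hLC]
    simp [ha]
  rw [hgoal]
  refine hbound.trans ?_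
  have hfin := mul_le_mul_of_nonneg_left
    (aliasing_le_mul_norm_windowIntegral hm' (half_inv_mem hσ) hν) hC0
  rw [hnorm, windowError, show 1 - 1 / σ = 1 - 2 * (1 / (2 * σ)) by ring, shapeParam_eq]
  linarith

/-- The aliasing comparison bounds a positive number by a multiple of the transform, which therefore
cannot vanish. -/
theorem hat_phiSinh_ne_zero {m L : ℕ} (hm : 2 ≤ m) (hL : 0 < L) {σ : ℝ}
    (hσ : σ ∈ Icc (5 / 4 : ℝ) 2) {w : ℝ} (hw : |w| ≤ L / (2 * σ)) :
    hat (phiSinh m σ L) w ≠ 0 := by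
  have hm' : (2 : ℝ) ≤ m := by exact_mod_cast hm
  have hL' : (0 : ℝ) < L := Nat.cast_pos.2 hL
  have hβ := shapeParam_ge hm hσ
  have hsinh : 0 < Real.sinh (shapeParam m σ) := Real.sinh_pos_iff.2 (by linarith)
  have h := aliasing_le_mul_norm_windowIntegral hm' (half_inv_mem hσ) (abs_div_le_half_inv hL hw)
  rw [← shapeParam_eq] at h
  rw [hat_phiSinh (by omega) hL]
  refine mul_ne_zero (ofReal_ne_zero.2 (by positivity)) fun h0 => ?_
  rw [h0, norm_zero, mul_zero] at h
  linarith

/-- This compares the ℓ¹ bound for the g_l with |φ̂|. Since |φ̂(w)| ≥ (m/(L sinh β)) β e^z/(z√z) and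
sinh β ≤ e^β/2, the exponential lost is e^{β-z}, which appears in the error constant. -/
theorem le_mul_norm_hat_phiSinh {m L : ℕ} (hm : 2 ≤ m) (hL : 0 < L) {σ : ℝ}
    (hσ : σ ∈ Icc (5 / 4 : ℝ) 2) {w : ℝ} (hw : |w| ≤ L / (2 * σ)) :
    3 / 2 * (m : ℝ) / L ≤ (2 * (L : ℝ) + 4 * m) / √(2 * m * Real.pi) *
      Real.exp (2 * Real.pi * m * (1 - √(1 - 1 / σ) - 1 / (2 * σ))) *
        ‖hat (phiSinh m σ L) w‖ := by
  have hm' : (2 : ℝ) ≤ m := by exact_mod_cast hm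
  have hL' : (0 : ℝ) < L := Nat.cast_pos.2 hL
  have hβ := shapeParam_ge hm hσ
  have hsinh : 0 < Real.sinh (shapeParam m σ) := Real.sinh_pos_iff.2 (by linarith)
  have hpi' := Real.pi_lt_d2
  obtain ⟨hz5, hzm, hV⟩ := low_frequency_bounds hm' (half_inv_mem hσ) (abs_div_le_half_inv hL hw)
  have hsq : √(1 - 2 * (1 / (2 * σ))) ≤ 1 - 1 / (2 * σ) := by
    have := (half_inv_mem hσ).2
    rw [Real.sqrt_le_left (by linarith)]
    nlinarith [sq_nonneg (1 / (2 * σ))]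
  have hzβ : 2 * Real.pi * m * √(1 - 2 * (1 / (2 * σ))) ≤ shapeParam m σ := by
    rw [shapeParam_eq]
    gcongr
  rw [show 2 * Real.pi * m * (1 - √(1 - 1 / σ) - 1 / (2 * σ)) =
    shapeParam m σ - 2 * Real.pi * m * √(1 - 2 * (1 / (2 * σ))) by
      rw [shapeParam_eq, show 1 - 1 / σ = 1 - 2 * (1 / (2 * σ)) by ring]; ring]
  rw [← shapeParam_eq] at hV
  rw [hat_phiSinh (by omega) hL, norm_mul, norm_real, Real.norm_eq_abs,
    abs_of_nonneg (by positivity)]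
  set z := 2 * Real.pi * m * √(1 - 2 * (1 / (2 * σ)))
  set β := shapeParam m σ
  have hz0 : 0 < z := by linarith
  have hβ0 : 0 < β := by linarith
  have hs0 : 0 < √(2 * m * Real.pi) := Real.sqrt_pos.2 (by positivity)
  -- The summand 4m alone suffices: 4.46 · 6.3 ≤ (16/3)².
  have hR : 3 / 4 * √z ≤ (2 * (L : ℝ) + 4 * m) / √(2 * m * Real.pi) := by
    rw [le_div_iff₀ hs0, mul_assoc, ← Real.sqrt_mul hz0.le]
    have : √(z * (2 * m * Real.pi)) ≤ 16 / 3 * m := by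
      rw [Real.sqrt_le_left (by positivity)]
      have h1 : 2 * m * Real.pi ≤ 6.3 * m := by nlinarith
      calc z * (2 * m * Real.pi) ≤ 4.46 * m * (6.3 * m) := by gcongr
        _ ≤ _ := by nlinarith [sq_nonneg (m : ℝ)]
    linarith
  have hsinhle : Real.sinh β ≤ Real.exp β / 2 := by
    rw [Real.sinh_eq]
    linarith [Real.exp_pos (-β)]
  calc 3 / 2 * (m : ℝ) / L = 3 / 2 * Real.sinh β * (z * √z) * (m / (L * Real.sinh β) *
        (1 / (z * √z))) := by field_simp
    _ ≤ 3 / 2 * (Real.exp β / 2) * (β * √z) * (m / (L * Real.sinh β) * (1 / (z * √z))) := by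
        gcongr
    _ = 3 / 4 * √z * Real.exp (β - z) * (m / (L * Real.sinh β) *
        (β * (Real.exp z / (z * √z)))) := by
        rw [Real.exp_sub]; field_simp; ring
    _ ≤ _ := by gcongr

/-! ### Sums of window samples -/

theorem card_le_of_abs_sub_lt {S : Finset ℤ} {c : ℝ} {n : ℕ}
    (h : ∀ l ∈ S, |(l : ℝ) - c| < n / 2) : S.card ≤ n := by
  have hsub : S ⊆ Finset.Icc (⌊c - n / 2⌋ + 1) (⌊c - n / 2⌋ + n) := by
    intro l hl
    obtain ⟨h1, h2⟩ := abs_lt.1 (h l hl)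
    rw [Finset.mem_Icc]
    constructor
    · exact Int.add_one_le_of_lt (Int.floor_lt.2 (by linarith))
    · have : l - n ≤ ⌊c - n / 2⌋ := Int.le_floor.2 (by push_cast; linarith)
      linarith
  have := Finset.card_le_card hsub
  rw [Int.card_Icc] at this
  omega

theorem omegaSinh_nonneg {β : ℝ} (hβ : 0 < β) (x : ℝ) : 0 ≤ omegaSinh β x := by
  rw [omegaSinh_eq]
  exact div_nonneg (Real.sinh_nonneg_iff.2 (by positivity)) (Real.sinh_nonneg_iff.2 hβ.le)

theorem omegaSinh_le_one {β : ℝ} (hβ : 0 < β) (x : ℝ) : omegaSinh β x ≤ 1 := by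
  rw [omegaSinh_eq, div_le_one (Real.sinh_pos_iff.2 hβ), Real.sinh_le_sinh]
  refine mul_le_of_le_one_right hβ.le ?_
  rw [Real.sqrt_le_left zero_le_one]
  nlinarith [sq_nonneg x]

/-- For |x| ≥ 1/2 the root is at most √3/2 < 0.8661, and sinh β ≥ sinh(0.8661β) e^{0.1339β}, where
0.1339 · 7.5 > 1 makes the last factor at least 2. -/
theorem omegaSinh_le_half {β x : ℝ} (hβ : 7.5 ≤ β) (hx : 1 / 2 ≤ |x|) :
    omegaSinh β x ≤ 1 / 2 := by
  have hβ0 : 0 < β := by linarith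
  rw [omegaSinh_eq, div_le_iff₀ (Real.sinh_pos_iff.2 hβ0)]
  have hs : √(1 - x ^ 2) ≤ 0.8661 := by
    rw [Real.sqrt_le_left (by norm_num), ← sq_abs x]
    nlinarith
  have h1 : Real.sinh (β * √(1 - x ^ 2)) ≤ Real.sinh (0.8661 * β) :=
    Real.sinh_le_sinh.2 (by nlinarith)
  have h2 : Real.sinh β = Real.sinh (0.8661 * β) * Real.exp (0.1339 * β) +
      Real.exp (-(0.8661 * β)) * Real.sinh (0.1339 * β) := by
    rw [show β = 0.8661 * β + 0.1339 * β by ring, Real.sinh_add, ← Real.cosh_add_sinh,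
      ← Real.cosh_sub_sinh]
    ring_nf
  have h3 : 2 ≤ Real.exp (0.1339 * β) := by
    have := Real.add_one_le_exp (0.1339 * β)
    linarith
  have h4 : 0 ≤ Real.exp (-(0.8661 * β)) * Real.sinh (0.1339 * β) :=
    mul_nonneg (Real.exp_pos _).le (Real.sinh_nonneg_iff.2 (by positivity))
  have h5 : 0 ≤ Real.sinh (0.8661 * β) := Real.sinh_nonneg_iff.2 (by positivity)
  nlinarith

theorem phiSinh_nonneg {m L : ℕ} (hm : 2 ≤ m) {σ : ℝ} (hσ : σ ∈ Icc (5 / 4 : ℝ) 2) (t : ℝ) :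
    0 ≤ phiSinh m σ L t :=
  omegaSinh_nonneg (by linarith [shapeParam_ge hm hσ]) _

/-- A sum of regular samples of the sinh-type window is at most `3m/2`. -/
theorem sum_phiSinh_le {m L : ℕ} (hm : 2 ≤ m) (hL : 0 < L) {σ : ℝ}
    (hσ : σ ∈ Icc (5 / 4 : ℝ) 2) (S : Finset ℤ) (t : ℝ) :
    ∑ l ∈ S, phiSinh m σ L ((l : ℝ) / L - t) ≤ 3 / 2 * m := by
  classical
  have hL' : (0 : ℝ) < L := Nat.cast_pos.2 hL
  have hm' : (0 : ℝ) < m := Nat.cast_pos.2 (by omega)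
  have hβ := shapeParam_ge hm hσ
  -- A two-level majorant: at most 2m samples contribute 1/2, and at most m inner ones a further
  -- 1/2.
  have hpt : ∀ l : ℤ, phiSinh m σ L ((l : ℝ) / L - t) ≤
      (if |(l : ℝ) - L * t| < ((2 * m : ℕ) : ℝ) / 2 then (1 / 2 : ℝ) else 0) +
        (if |(l : ℝ) - L * t| < (m : ℝ) / 2 then (1 / 2 : ℝ) else 0) := by
    intro l
    have e : (L : ℝ) * ((l : ℝ) / L - t) / m = (l - L * t) / m := by field_simp
    have habs : |((l : ℝ) - L * t) / m| = |(l : ℝ) - L * t| / m := by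
      rw [abs_div, abs_of_pos hm']
    rw [phiSinh, e]
    push_cast
    split_ifs with h1 h2 h2
    · linarith [omegaSinh_le_one (show 0 < shapeParam m σ by linarith) (((l : ℝ) - L * t) / m)]
    · rw [add_zero]
      refine omegaSinh_le_half hβ ?_
      rw [habs, le_div_iff₀ hm']
      linarith
    · linarith
    · rw [add_zero, omegaSinh_eq_zero]
      rw [habs, le_div_iff₀ hm']
      linarith
  have hA := card_le_of_abs_sub_lt (S := S.filter fun l : ℤ =>
    |(l : ℝ) - L * t| < ((2 * m : ℕ) : ℝ) / 2) fun l hl => (Finset.mem_filter.1 hl).2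
  have hB := card_le_of_abs_sub_lt (S := S.filter fun l : ℤ =>
    |(l : ℝ) - L * t| < (m : ℝ) / 2) fun l hl => (Finset.mem_filter.1 hl).2
  refine (Finset.sum_le_sum fun l _ => hpt l).trans ?_
  rw [Finset.sum_add_distrib, ← Finset.sum_filter, ← Finset.sum_filter, Finset.sum_const,
    Finset.sum_const, nsmul_eq_mul, nsmul_eq_mul]
  have hA' := (Nat.cast_le (α := ℝ)).2 hA
  have hB' := (Nat.cast_le (α := ℝ)).2 hB
  push_cast at hA' hB' ⊢
  linarith

/-! ### The finite sums of the NNFFT -/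

theorem mem_indexSet_of_abs_lt {M : ℕ} (hM : Even M) {l : ℤ} (h : |(l : ℝ)| < M / 2) :
    l ∈ indexSet M := by
  obtain ⟨k, rfl⟩ := hM
  have h2 : (((k + k : ℕ) : ℤ) / 2) = k := by omega
  rw [indexSet, h2, Finset.mem_Ico]
  push_cast at h
  obtain ⟨h3, h4⟩ := abs_lt.1 h
  constructor
  · have : (((-k : ℤ)) : ℝ) < l := by push_cast; linarith
    exact (Int.cast_lt.1 this).le
  · have : (l : ℝ) < ((k : ℤ) : ℝ) := by push_cast; linarith
    exact Int.cast_lt.1 this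

theorem abs_le_of_mem_indexSet {M : ℕ} {l : ℤ} (h : l ∈ indexSet M) : |(l : ℝ)| ≤ M / 2 := by
  rw [indexSet, Finset.mem_Ico] at h
  have h1 : |2 * l| ≤ (M : ℤ) := abs_le.2 (by omega)
  have h2 : ((|2 * l| : ℤ) : ℝ) ≤ ((M : ℤ) : ℝ) := Int.cast_le.2 h1
  push_cast at h2
  rw [abs_mul, abs_of_pos (by norm_num : (0 : ℝ) < 2)] at h2
  linarith

/-- Finite version of the approximation of an exponential by translated windows. -/
theorem norm_window_finsum_sub_le {m L : ℕ} (hm : 2 ≤ m) (hL : 0 < L) {σ : ℝ}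
    (hσ : σ ∈ Icc (5 / 4 : ℝ) 2) {w : ℝ} (hw : |w| ≤ L / (2 * σ)) {M : ℕ} (hM : Even M) {t : ℝ}
    (ht : L * |t| + m ≤ M / 2) :
    ‖1 / (L : ℂ) * (∑ l ∈ indexSet M, (phiSinh m σ L (l / L - t) : ℂ) * phase (l * w / L)) -
      hat (phiSinh m σ L) w * phase (t * w)‖ ≤ windowError m σ * ‖hat (phiSinh m σ L) w‖ := by
  have hL' : (0 : ℝ) < L := Nat.cast_pos.2 hL
  have h := norm_window_sum_sub_le hm hL hσ hw t
  -- Truncation is exact: by `ht` the open support lies in |l| < M/2, and the window vanishes at the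
  -- ends, so omitting l = M/2 costs nothing.
  rwa [tsum_eq_sum (s := indexSet M)] at h
  intro l hl
  rw [phiSinh_eq_zero (by omega), ofReal_zero, zero_mul]
  by_contra hlt
  refine hl (mem_indexSet_of_abs_lt hM ?_)
  rw [mul_sub, mul_div_cancel₀ _ hL'.ne', not_le] at hlt
  calc |(l : ℝ)| = |(l - L * t) + L * t| := by ring_nf
    _ ≤ |(l : ℝ) - L * t| + |L * t| := abs_add_le _ _
    _ < m + L * |t| := by rw [abs_mul, abs_of_pos hL']; linarith
    _ ≤ M / 2 := by linarith

theorem continuous_hat_phiSinh {m L : ℕ} (hm : 0 < m) (hL : 0 < L) (σ : ℝ) :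
    Continuous (hat (phiSinh m σ L)) := by
  have h := continuous_windowIntegral (shapeParam m σ)
  rw [show hat (phiSinh m σ L) = _ from funext (hat_phiSinh hm hL σ)]
  fun_prop

/-- The localization discards only zero terms; without it the index set no longer depends on x, so
continuity in x is visible. -/
theorem shortSum_eq_sum {m₂ N₂ : ℕ} (hm : 0 < m₂) (hN₂ : 0 < N₂) (φ₁ : ℝ → ℝ) (σ₁ σ₂ : ℝ)
    (N₁ m₁ M₁ : ℕ) (v : ℤ → ℝ) (f : ℤ → ℂ) (x : ℝ) :
    shortSum φ₁ (phiSinh m₂ σ₂ N₂) σ₁ N₁ N₂ m₁ m₂ M₁ v f x =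
      ∑ s ∈ indexSet N₂, hCoeff φ₁ (phiSinh m₂ σ₂ N₂) N₁ N₂ m₁ M₁ v f s *
        (phiSinh m₂ σ₂ N₂ ((s : ℝ) / N₂ - x / σ₁) : ℂ) := by
  have hN : (0 : ℝ) < N₂ := Nat.cast_pos.2 hN₂
  rw [shortSum]
  refine (Finset.sum_filter_of_ne fun s _ hs => ?_).trans (Finset.sum_congr rfl fun s _ => ?_)
  · by_contra hlt
    refine hs ?_
    rw [phiSinh_eq_zero hm, ofReal_zero, mul_zero]
    rw [not_lt, div_le_iff₀ hN] at hlt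
    rwa [abs_mul, abs_of_pos hN, abs_sub_comm, mul_comm]
  · rw [← phiSinh_neg, neg_sub]

/-- The NNFFT value before deconvolution, with the two summations interchanged. -/
theorem shortSum_eq_sum_gCoeff {m₂ N₂ : ℕ} (hm : 0 < m₂) (hN₂ : 0 < N₂) (φ₁ : ℝ → ℝ) (σ₁ σ₂ : ℝ)
    (N₁ m₁ M₁ : ℕ) (v : ℤ → ℝ) (f : ℤ → ℂ) (x : ℝ) :
    shortSum φ₁ (phiSinh m₂ σ₂ N₂) σ₁ N₁ N₂ m₁ m₂ M₁ v f x =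
      ∑ l ∈ indexSet (N₁ + 2 * m₁), gCoeff φ₁ N₁ M₁ v f l *
        ((1 / (N₂ : ℂ) * ∑ s ∈ indexSet N₂, (phiSinh m₂ σ₂ N₂ ((s : ℝ) / N₂ - x / σ₁) : ℂ) *
          phase (s * l / N₂)) / hat (phiSinh m₂ σ₂ N₂) l) := by
  rw [shortSum_eq_sum hm hN₂]
  simp only [hCoeff, gHatCoeff, Finset.mul_sum, Finset.sum_mul, Finset.sum_div]
  rw [Finset.sum_comm]
  refine Finset.sum_congr rfl fun l _ => Finset.sum_congr rfl fun s _ => ?_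
  rw [← phase, mul_comm (l : ℝ) s]
  ring

theorem sum_gCoeff_mul_phase (φ₁ : ℝ → ℝ) (N₁ M₁ : ℕ) (v : ℤ → ℝ) (f : ℤ → ℂ) (S : Finset ℤ)
    (p : ℤ → ℂ) :
    ∑ l ∈ S, gCoeff φ₁ N₁ M₁ v f l * p l = ∑ k ∈ indexSet M₁, f k *
      (1 / (N₁ : ℂ) * ∑ l ∈ S, (φ₁ ((l : ℝ) / N₁ - v k) : ℂ) * p l) := by
  simp only [gCoeff, Finset.mul_sum, Finset.sum_mul]
  rw [Finset.sum_comm]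
  refine Finset.sum_congr rfl fun k _ => Finset.sum_congr rfl fun l _ => ?_
  ring

/-- The window is nonnegative, so after interchanging sums each k contributes a plain sum of
samples. -/
theorem sum_norm_gCoeff_le {m N₁ : ℕ} (hm : 2 ≤ m) (hN₁ : 0 < N₁) {σ : ℝ}
    (hσ : σ ∈ Icc (5 / 4 : ℝ) 2) (M₁ : ℕ) (v : ℤ → ℝ) (f : ℤ → ℂ) (S : Finset ℤ) :
    ∑ l ∈ S, ‖gCoeff (phiSinh m σ N₁) N₁ M₁ v f l‖ ≤
      3 / 2 * m / N₁ * ∑ k ∈ indexSet M₁, ‖f k‖ := by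
  have hN : (0 : ℝ) < N₁ := Nat.cast_pos.2 hN₁
  have h1 : ∀ l ∈ S, ‖gCoeff (phiSinh m σ N₁) N₁ M₁ v f l‖ ≤
      ∑ k ∈ indexSet M₁, 1 / (N₁ : ℝ) * ‖f k‖ * phiSinh m σ N₁ ((l : ℝ) / N₁ - v k) := by
    intro l _
    rw [gCoeff, norm_mul, norm_div, norm_one, norm_natCast]
    calc _ ≤ 1 / (N₁ : ℝ) * ∑ k ∈ indexSet M₁,
          ‖f k * (phiSinh m σ N₁ ((l : ℝ) / N₁ - v k) : ℂ)‖ := by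
          gcongr
          exact norm_sum_le _ _
      _ = _ := by
          rw [Finset.mul_sum]
          refine Finset.sum_congr rfl fun k _ => ?_
          rw [norm_mul, norm_real, Real.norm_eq_abs, abs_of_nonneg (phiSinh_nonneg hm hσ _),
            mul_assoc]
  refine (Finset.sum_le_sum h1).trans ?_
  rw [Finset.sum_comm, Finset.mul_sum]
  refine Finset.sum_le_sum fun k _ => ?_
  rw [← Finset.mul_sum]
  calc _ ≤ 1 / (N₁ : ℝ) * ‖f k‖ * (3 / 2 * m) := by
        gcongr
        exact sum_phiSinh_le hm hN₁ hσ S (v k)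
    _ = _ := by ring

/-- Combination of the two window approximations. -/
theorem norm_sub_div_le {ι κ : Type*} {S : Finset ι} {T : Finset κ} {f e : ι → ℂ} {B : ι → ℂ}
    {g p A : κ → ℂ} {H : ℂ} (hH : H ≠ 0) {ε₁ ε₂ R : ℝ} (hε₂ : 0 ≤ ε₂)
    (hB : ∀ k ∈ S, ‖B k - H * e k‖ ≤ ε₁ * ‖H‖) (hA : ∀ l ∈ T, ‖A l - p l‖ ≤ ε₂)
    (hgp : ∑ l ∈ T, g l * p l = ∑ k ∈ S, f k * B k)
    (hg : ∑ l ∈ T, ‖g l‖ ≤ R * ‖H‖ * ∑ k ∈ S, ‖f k‖) :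
    ‖∑ k ∈ S, f k * e k - (∑ l ∈ T, g l * A l) / H‖ ≤ (ε₁ + R * ε₂) * ∑ k ∈ S, ‖f k‖ := by
  have hH0 : 0 < ‖H‖ := norm_pos_iff.2 hH
  -- Insert ∑ g_l p_l = ∑ f_k B_k: the error splits into one part per window, both divided by H.
  have h1 : ∑ k ∈ S, f k * e k - (∑ l ∈ T, g l * A l) / H =
      -((∑ k ∈ S, f k * (B k - H * e k)) + ∑ l ∈ T, g l * (A l - p l)) / H := by
    simp only [mul_sub, Finset.sum_sub_distrib, hgp]
    rw [eq_div_iff hH, sub_mul, div_mul_cancel₀ _ hH, Finset.sum_mul]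
    rw [Finset.sum_congr rfl fun k _ => show f k * e k * H = f k * (H * e k) by ring]
    ring
  have h2 : ‖∑ k ∈ S, f k * (B k - H * e k)‖ ≤ (∑ k ∈ S, ‖f k‖) * (ε₁ * ‖H‖) := by
    rw [Finset.sum_mul]
    refine norm_sum_le_of_le _ fun k hk => ?_
    rw [norm_mul]
    exact mul_le_mul_of_nonneg_left (hB k hk) (norm_nonneg _)
  have h3 : ‖∑ l ∈ T, g l * (A l - p l)‖ ≤ (∑ l ∈ T, ‖g l‖) * ε₂ := by
    rw [Finset.sum_mul]
    refine norm_sum_le_of_le _ fun l hl => ?_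
    rw [norm_mul]
    exact mul_le_mul_of_nonneg_left (hA l hl) (norm_nonneg _)
  have h4 := mul_le_mul_of_nonneg_right hg hε₂
  rw [h1, norm_div, norm_neg, div_le_iff₀ hH0]
  refine (norm_add_le _ _).trans ?_
  linarith

theorem continuous_expSum (N M₁ : ℕ) (v : ℤ → ℝ) (f : ℤ → ℂ) : Continuous (expSum N M₁ v f) := by
  unfold expSum
  fun_prop

theorem continuous_shortSum {m₂ N₂ : ℕ} (hm : 0 < m₂) (hN₂ : 0 < N₂) (φ₁ : ℝ → ℝ) (σ₁ σ₂ : ℝ)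
    (N₁ m₁ M₁ : ℕ) (v : ℤ → ℝ) (f : ℤ → ℂ) :
    Continuous (shortSum φ₁ (phiSinh m₂ σ₂ N₂) σ₁ N₁ N₂ m₁ m₂ M₁ v f) := by
  have h := continuous_phiSinh m₂ σ₂ N₂
  rw [show shortSum φ₁ (phiSinh m₂ σ₂ N₂) σ₁ N₁ N₂ m₁ m₂ M₁ v f = _ from
    funext (shortSum_eq_sum hm hN₂ φ₁ σ₁ σ₂ N₁ m₁ M₁ v f)]
  fun_prop

end NNFFT

/-! ### The error estimate -/

theorem mainTheorem1
    (N N₁ N₂ m₁ m₂ M₁ M₂ : ℕ) (σ₁ σ₂ : ℝ)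
    (hN : 0 < N)
    (hσ₁ : σ₁ ∈ Set.Icc (5 / 4 : ℝ) 2) (hσ₂ : σ₂ ∈ Set.Icc (5 / 4 : ℝ) 2)
    (hN₁ : (N₁ : ℝ) = σ₁ * N) (hN₁even : Even N₁)
    (hm₁ : 2 ≤ m₁)
    (hN₂ : (N₂ : ℝ) = σ₂ * (N₁ + 2 * m₁)) (hN₂even : Even N₂)
    (hm₂ : 2 ≤ m₂) (hm₂N₂ : 2 * (m₂ : ℝ) ≤ (1 - 1 / σ₁) * N₂)
    (hm : m₁ ≤ m₂)
    (hM₁ : 0 < M₁) (hM₁even : Even M₁) (hM₂ : 0 < M₂) (hM₂even : Even M₂)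
    (f : ℤ → ℂ) (v x : ℤ → ℝ)
    (hv : ∀ k ∈ NNFFT.indexSet M₁,
      v k ∈ Set.Icc (-(1 / (2 * NNFFT.aConst m₁ N₁))) (1 / (2 * NNFFT.aConst m₁ N₁)))
    (hx : ∀ j ∈ NNFFT.indexSet M₂, x j ∈ Set.Icc (-(1 / 2) : ℝ) (1 / 2)) :
    (∀ y ∈ Set.Icc (-(1 / 2) : ℝ) (1 / 2), NNFFT.hat (NNFFT.phiSinh m₁ σ₁ N₁) (N * y) ≠ 0) ∧
    (∀ l ∈ NNFFT.indexSet (N₁ + 2 * m₁), NNFFT.hat (NNFFT.phiSinh m₂ σ₂ N₂) l ≠ 0) ∧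
    ∃ maxNodes maxAll : ℝ,
      IsGreatest ((fun j : ℤ => ‖NNFFT.expSum N M₁ v f (x j) -
          NNFFT.nnfftSinh σ₁ σ₂ N N₁ N₂ m₁ m₂ M₁ v f (x j)‖) ''
        (NNFFT.indexSet M₂ : Set ℤ)) maxNodes ∧
      IsGreatest ((fun y : ℝ => ‖NNFFT.expSum N M₁ v f y -
          NNFFT.nnfftSinh σ₁ σ₂ N N₁ N₂ m₁ m₂ M₁ v f y‖) ''
        Set.Icc (-(1 / 2) : ℝ) (1 / 2)) maxAll ∧
      maxNodes ≤ maxAll ∧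
      maxAll ≤ NNFFT.errorConst σ₁ σ₂ N₁ m₁ m₂ * ∑ k ∈ NNFFT.indexSet M₁, ‖f k‖ := by
  open NNFFT in
  have hσ₁0 : 0 < σ₁ := by linarith [hσ₁.1]
  have hσ₂0 : 0 < σ₂ := by linarith [hσ₂.1]
  have hN' : (0 : ℝ) < N := Nat.cast_pos.2 hN
  have hN₁0 : (0 : ℝ) < N₁ := by rw [hN₁]; positivity
  have hN₂0 : (0 : ℝ) < N₂ := by rw [hN₂]; positivity
  have hN₁p : 0 < N₁ := Nat.cast_pos.1 hN₁0
  have hN₂p : 0 < N₂ := Nat.cast_pos.1 hN₂0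
  -- N₁/(2σ₁) = N/2 and N₂/(2σ₂) = (N₁+2m₁)/2, so both families of frequencies fit the admissible
  -- band of their window.
  have hlow₁ : ∀ y ∈ Set.Icc (-(1 / 2) : ℝ) (1 / 2), |(N : ℝ) * y| ≤ N₁ / (2 * σ₁) := by
    intro y hy
    rw [hN₁, abs_mul, abs_of_pos hN']
    calc (N : ℝ) * |y| ≤ N * (1 / 2) := by gcongr; exact abs_le.2 hy
      _ = _ := by field_simp
  have hlow₂ : ∀ l ∈ indexSet (N₁ + 2 * m₁), |(l : ℝ)| ≤ N₂ / (2 * σ₂) := by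
    intro l hl
    refine (abs_le_of_mem_indexSet hl).trans (le_of_eq ?_)
    rw [hN₂]
    push_cast
    field_simp
  have hne₁ : ∀ y ∈ Set.Icc (-(1 / 2) : ℝ) (1 / 2), hat (phiSinh m₁ σ₁ N₁) (N * y) ≠ 0 :=
    fun y hy => hat_phiSinh_ne_zero hm₁ hN₁p hσ₁ (hlow₁ y hy)
  have hne₂ : ∀ l ∈ indexSet (N₁ + 2 * m₁), hat (phiSinh m₂ σ₂ N₂) l ≠ 0 :=
    fun l hl => hat_phiSinh_ne_zero hm₂ hN₂p hσ₂ (hlow₂ l hl)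
  have hbound : ∀ y ∈ Set.Icc (-(1 / 2) : ℝ) (1 / 2),
      ‖expSum N M₁ v f y - nnfftSinh σ₁ σ₂ N N₁ N₂ m₁ m₂ M₁ v f y‖ ≤
        errorConst σ₁ σ₂ N₁ m₁ m₂ * ∑ k ∈ indexSet M₁, ‖f k‖ := by
    intro y hy
    rw [nnfftSinh, nnfft, shortSum_eq_sum_gCoeff (by omega) hN₂p]
    have hy' : |y / σ₁| ≤ 1 / (2 * σ₁) := by
      rw [abs_div, abs_of_pos hσ₁0]
      calc |y| / σ₁ ≤ 1 / 2 / σ₁ := by gcongr; exact abs_le.2 hy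
        _ = _ := by field_simp
    have h := norm_sub_div_le (S := indexSet M₁) (T := indexSet (N₁ + 2 * m₁)) (f := f)
      (e := fun k => phase (v k * (N * y)))
      (B := fun k => 1 / (N₁ : ℂ) * ∑ l ∈ indexSet (N₁ + 2 * m₁),
        (phiSinh m₁ σ₁ N₁ ((l : ℝ) / N₁ - v k) : ℂ) * phase (l * (N * y) / N₁))
      (g := gCoeff (phiSinh m₁ σ₁ N₁) N₁ M₁ v f)
      (p := fun l => phase (l * (N * y) / N₁))
      (A := fun l => (1 / (N₂ : ℂ) * ∑ s ∈ indexSet N₂,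
        (phiSinh m₂ σ₂ N₂ ((s : ℝ) / N₂ - y / σ₁) : ℂ) * phase (s * l / N₂)) /
          hat (phiSinh m₂ σ₂ N₂) l)
      (hne₁ y hy) (ε₁ := windowError m₁ σ₁) (ε₂ := windowError m₂ σ₂)
      (R := (2 * (N₁ : ℝ) + 4 * m₁) / √(2 * m₁ * Real.pi) *
        Real.exp (2 * Real.pi * m₁ * (1 - √(1 - 1 / σ₁) - 1 / (2 * σ₁))))
      (by unfold windowError; positivity)
      (fun k hk => norm_window_finsum_sub_le hm₁ hN₁p hσ₁ (hlow₁ y hy)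
        (hN₁even.add (even_two_mul m₁)) (by
          -- It gives |v k| ≤ 1/2, so the translated window fits in the grid enlarged by m₁ points
          -- on each side.
          have ha : 1 ≤ aConst m₁ N₁ := by
            unfold aConst
            linarith [show (0 : ℝ) ≤ 2 * (m₁ : ℝ) / N₁ by positivity]
          have h1 : |v k| ≤ 1 / 2 := (abs_le.2 (hv k hk)).trans
            (one_div_le_one_div_of_le (by norm_num) (by linarith))
          push_cast
          nlinarith))
      (fun l hl => by
        have h2 := norm_window_finsum_sub_le hm₂ hN₂p hσ₂ (hlow₂ l hl) hN₂even (t := y / σ₁) (by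
          -- The fit N₂/(2σ₁) + m₂ ≤ N₂/2 is exactly `hm₂N₂`.
          have : (N₂ : ℝ) * |y / σ₁| ≤ N₂ * (1 / (2 * σ₁)) := by gcongr
          have e : (N₂ : ℝ) * (1 / (2 * σ₁)) = 1 / σ₁ * N₂ / 2 := by field_simp
          linarith)
        have h3 : (l : ℝ) * (N * y) / N₁ = y / σ₁ * l := by
          rw [hN₁]
          field_simp
        rw [h3, div_sub' (hne₂ l hl), norm_div, div_le_iff₀ (norm_pos_iff.2 (hne₂ l hl))]
        exact h2)
      (sum_gCoeff_mul_phase _ _ _ _ _ _ _)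
      ((sum_norm_gCoeff_le hm₁ hN₁p hσ₁ M₁ v f _).trans (by
        gcongr
        exact le_mul_norm_hat_phiSinh hm₁ hN₁p hσ₁ (hlow₁ y hy)))
    have he : expSum N M₁ v f y = ∑ k ∈ indexSet M₁, f k * phase (v k * (N * y)) := by
      refine Finset.sum_congr rfl fun k _ => ?_
      rw [← phase]
      congr 2
      ring
    rw [he]
    refine h.trans (le_of_eq ?_)
    simp only [errorConst, windowError]
    ring
  -- Continuity on the compact interval, with a nonvanishing denominator, makes the maximum exist.
  have hcont : ContinuousOn (fun y : ℝ => ‖expSum N M₁ v f y -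
      nnfftSinh σ₁ σ₂ N N₁ N₂ m₁ m₂ M₁ v f y‖) (Set.Icc (-(1 / 2) : ℝ) (1 / 2)) := by
    refine ((continuous_expSum N M₁ v f).continuousOn.sub (ContinuousOn.div
      (continuous_shortSum (by omega) hN₂p _ _ _ _ _ _ _ _).continuousOn
      (Continuous.continuousOn ?_) hne₁)).norm
    exact (continuous_hat_phiSinh (by omega) hN₁p σ₁).comp (by fun_prop)
  obtain ⟨y₀, hy₀, hmax⟩ := isCompact_Icc.exists_isMaxOn ⟨0, by norm_num, by norm_num⟩ hcont
  have hnonempty : (indexSet M₂).Nonempty :=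
    ⟨0, mem_indexSet_of_abs_lt hM₂even (by
      rw [Int.cast_zero, abs_zero]
      have : (0 : ℝ) < M₂ := Nat.cast_pos.2 hM₂
      positivity)⟩
  obtain ⟨j₀, hj₀, hjmax⟩ := Finset.exists_max_image (indexSet M₂)
    (fun j : ℤ => ‖expSum N M₁ v f (x j) -
      nnfftSinh σ₁ σ₂ N N₁ N₂ m₁ m₂ M₁ v f (x j)‖) hnonempty
  refine ⟨hne₁, hne₂, _, _, ⟨⟨j₀, hj₀, rfl⟩, ?_⟩, ⟨⟨y₀, hy₀, rfl⟩, ?_⟩, hmax (hx j₀ hj₀),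
    hbound y₀ hy₀⟩
  · rintro _ ⟨j, hj, rfl⟩
    exact hjmax j hj
  · rintro _ ⟨y, hy, rfl⟩
    exact hmax hy
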